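/- \textbf{Definitions.} A \emph{probabilistic circuit} (PC) $\mathcal C$ over a finite set of variables $\mathbf V$ is a finite rooted directed acyclic graph (every node is reachable from the root) whose leaves are its input nodes and whose other nodes are sum or product nodes. An input node $n$ carries a set $\mathrm{sc}(n)=\mathbf W\subseteq \mathbf V$, its scope, and a real-valued function $f_n$ of the variables in $\mathbf W$. A product node encodes $f_n=\prod_{m\in \mathrm{in}(n)} f_m$ and a sum node encodes $f_n=\sum_{m\in \mathrm{in}(n)}\theta_{n,m}f_m$ with real weights $\theta_{n,m}$, where $\mathrm{in}(n)\neq\emptyset$ is the set of inputs of $n$; in both cases $\mathrm{sc}(n)=\bigcup_{m\in \mathrm{in}(n)}\mathrm{sc}(m)$. The function $f_{\mathcal C}$ is the function encoded by the root, and the size $|\mathcal C|$ is the number of edges. The PC is \emph{monotone} if all its weights and input functions are non-negative, and \emph{alternating} if no sum node is an input of a sum node and no product node is an input of a product node. It is \emph{structured-decomposable} if the inputs of each sum node all have the same scope, distinct inputs of each product node have disjoint scopes, and any two product nodes with the same scope split it in the same way (the non-empty scopes of their inputs form the same partition). It has \emph{input arity at most} $k$ if every input node has a scope of at most $k$ variables.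 \textbf{Theorem.} For $d\ge 0$ and binary variables $\mathbf V=(V_0,\dots,V_{d-1})\in\{0,1\}^d$ let $p_d(\mathbf V)=n(\mathbf V)+1\geq 0$, where $n(\mathbf V)=\sum_{i=0}^{d-1}2^iV_i$ is the integer with binary digits $\mathbf V$. (1) There is a constant $A$ such that for every $d$ there is an alternating, monotone, structured-decomposable PC $\mathcal C$ with input arity at most $1$, of size $|\mathcal C|\le A d$, with $f_{\mathcal C}=p_d$. (2) For every $d$ there are alternating structured-decomposable PCs $\mathcal C'$ with input arity at most $1$ such that $f_{\mathcal C'}^2=p_d$. All such circuits, even without the alternation condition and with any fixed bound on the input arity, have size $2^{\Omega(d)}$: there is a constant $c>0$ such that for every $k$ there is $d_0$ such that for all $d\ge d_0$, every structured-decomposable PC $\mathcal C'$ over $\mathbf V$ with input arity at most $k$ and $f_{\mathcal C'}^2=p_d$ satisfies $|\mathcal C'|\ge 2^{cd}$. -/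

import Mathlib

/-- The three types of nodes of a probabilistic circuit over variables `ι` with values in `α`:
an input node carries its scope `W` and a real function of the variables in `W`;
a sum node carries its weights (only those on its inputs are ever used). -/
inductive PCNode (ι α N : Type) : Type where
  | input (W : Finset ι) (f : (W → α) → ℝ) : PCNode ι α N
  | prod : PCNode ι α N
  | sum (θ : N → ℝ) : PCNode ι α N

/-- Node is an input node. -/
def PCNode.IsInput {ι α N : Type} : PCNode ι α N → Prop
  | .input _ _ => True
  | .prod => False
  | .sum _ => False

/-- Node is a product node. -/
def PCNode.IsProd {ι α N : Type} : PCNode ι α N → Prop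
  | .input _ _ => False
  | .prod => True
  | .sum _ => False

/-- Node is a sum node. -/
def PCNode.IsSum {ι α N : Type} : PCNode ι α N → Prop
  | .input _ _ => False
  | .prod => False
  | .sum _ => True

/-- A probabilistic circuit with real parameters: a finite rooted directed acyclic graph whose
leaves are exactly the input nodes. `inp n` is the set of inputs of the node `n`. -/
structure PC (ι α : Type) where
  Node : Type
  fin : Fintype Node
  inp : Node → Finset Node
  acyclic : ∀ n, ¬ Relation.TransGen (fun m n => m ∈ inp n) n n
  root : Node
  rooted : ∀ n, Relation.ReflTransGen (fun m n => m ∈ inp n) n root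
  node : Node → PCNode ι α Node
  leaf_iff : ∀ n, inp n = ∅ ↔ (node n).IsInput

namespace PC

/-- The relation "is an input of" is well-founded, the graph being finite and acyclic. -/
theorem wf {ι α : Type} (C : PC ι α) : WellFounded (fun m n => m ∈ C.inp n) := by
  have := C.fin
  have h : WellFounded (Relation.TransGen (fun m n => m ∈ C.inp n)) := by
    have : Std.Irrefl (Relation.TransGen (fun m n => m ∈ C.inp n)) := ⟨C.acyclic⟩
    exact Finite.wellFounded_of_trans_of_irrefl _
  exact Subrelation.wf (fun hab => Relation.TransGen.single hab) h

/-- The scope of a node. -/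
noncomputable def scope {ι α : Type} [DecidableEq ι] (C : PC ι α) : C.Node → Finset ι :=
  C.wf.fix fun n ih =>
    match C.node n with
    | .input W _ => W
    | .prod => (C.inp n).attach.biUnion fun m => ih m.1 m.2
    | .sum _ => (C.inp n).attach.biUnion fun m => ih m.1 m.2

/-- The function encoded by a node, as a function of an assignment to all the variables. -/
noncomputable def nodeFun {ι α : Type} (C : PC ι α) : C.Node → (ι → α) → ℝ :=
  C.wf.fix fun n ih x =>
    match C.node n with
    | .input W f => f fun i : W => x i
    | .prod => ∏ m ∈ (C.inp n).attach, ih m.1 m.2 x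
    | .sum θ => ∑ m ∈ (C.inp n).attach, θ m.1 * ih m.1 m.2 x

/-- Defining equation of the scope. -/
theorem scope_eq {ι α : Type} [DecidableEq ι] (C : PC ι α) (n : C.Node) :
    C.scope n = match C.node n with
      | .input W _ => W
      | .prod => (C.inp n).biUnion C.scope
      | .sum _ => (C.inp n).biUnion C.scope := by
  unfold scope
  rw [WellFounded.fix_eq]
  cases C.node n with
  | input W f => rfl
  | prod => ext i; simp
  | sum θ => ext i; simp

/-- Defining equation of the function encoded by a node. -/
theorem nodeFun_eq {ι α : Type} (C : PC ι α) (n : C.Node) (x : ι → α) :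
    C.nodeFun n x = match C.node n with
      | .input W f => f fun i : W => x i
      | .prod => ∏ m ∈ C.inp n, C.nodeFun m x
      | .sum θ => ∑ m ∈ C.inp n, θ m * C.nodeFun m x := by
  unfold nodeFun
  rw [WellFounded.fix_eq]
  cases C.node n with
  | input W f => rfl
  | prod => exact Finset.prod_attach (C.inp n) (fun m => C.nodeFun m x)
  | sum θ => exact Finset.sum_attach (C.inp n) (fun m => θ m * C.nodeFun m x)

/-- The function encoded by the circuit. -/
noncomputable def eval {ι α : Type} (C : PC ι α) : (ι → α) → ℝ := C.nodeFun C.root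

/-- The size of the circuit: its number of edges. -/
def size {ι α : Type} (C : PC ι α) : ℕ :=
  letI := C.fin
  ∑ n : C.Node, (C.inp n).card

/-- All inputs of a sum node have the same scope. -/
def Smooth {ι α : Type} [DecidableEq ι] (C : PC ι α) : Prop :=
  ∀ n, (C.node n).IsSum → ∀ m ∈ C.inp n, ∀ m' ∈ C.inp n, C.scope m = C.scope m'

/-- Distinct inputs of a product node have disjoint scopes. -/
def Decomposable {ι α : Type} [DecidableEq ι] (C : PC ι α) : Prop :=
  ∀ n, (C.node n).IsProd → ∀ m ∈ C.inp n, ∀ m' ∈ C.inp n, m ≠ m' →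
    Disjoint (C.scope m) (C.scope m')

/-- The blocks into which a product node splits its scope: the nonempty scopes of its inputs. -/
def blocks {ι α : Type} [DecidableEq ι] (C : PC ι α) (n : C.Node) : Set (Finset ι) :=
  {s | s.Nonempty ∧ ∃ m ∈ C.inp n, C.scope m = s}

/-- Smooth, decomposable, and any two product nodes with the same scope split it in the same
way. -/
def StructuredDecomposable {ι α : Type} [DecidableEq ι] (C : PC ι α) : Prop :=
  C.Smooth ∧ C.Decomposable ∧
    ∀ n n', (C.node n).IsProd → (C.node n').IsProd → C.scope n = C.scope n' →
      C.blocks n = C.blocks n'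

/-- All weights are nonnegative and all input functions are nonnegative. -/
def Monotone {ι α : Type} (C : PC ι α) : Prop :=
  ∀ n, match C.node n with
    | .input _ f => ∀ w, 0 ≤ f w
    | .prod => True
    | .sum θ => ∀ m ∈ C.inp n, 0 ≤ θ m

/-- Sum and product nodes alternate: no sum is an input of a sum, no product of a product. -/
def Alternating {ι α : Type} (C : PC ι α) : Prop :=
  ∀ n, ∀ m ∈ C.inp n, ¬ ((C.node n).IsSum ∧ (C.node m).IsSum) ∧
    ¬ ((C.node n).IsProd ∧ (C.node m).IsProd)

/-- Every input node is a function of at most `k` variables. -/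
def InputArityLE {ι α : Type} (C : PC ι α) (k : ℕ) : Prop :=
  ∀ n, match C.node n with
    | .input W _ => W.card ≤ k
    | .prod => True
    | .sum _ => True

end PC

/-- The integer whose binary digits are `v`, the digit `v i` having weight `2 ^ i`. -/
def binaryValue {d : ℕ} (v : Fin d → Bool) : ℕ := ∑ i : Fin d, if v i then 2 ^ (i : ℕ) else 0

/-- The target function `p(v) = n(v) + 1`. -/
def binarySucc (d : ℕ) (v : Fin d → Bool) : ℝ := (binaryValue v : ℝ) + 1

/-! The lower bound is a rank argument. In a structured-decomposable circuit all product nodes with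
a given large scope split it alike. Descending from the root therefore yields one set `X` of between
`d/3` and `2d/3` variables such that the root function is a sum, over the nodes `P`, of a function
of the variables in `X` times a function of the others (`exists_balanced_cut`). Hence every matrix
`f (merge X (v i) (v j))` has rank at most the number of nodes, which is at most the size plus one.

If `f ^ 2 = binarySucc d`, the entries of such a matrix are square roots, of arbitrary sign, of
integers in `[1, 2 ^ d]`. A prime above `2 ^ (d - 1)` divides no other integer in this range. Take
assignments whose values are such primes and whose restrictions to `X` and to its complement are
pairwise distinct: each prime then occurs on the diagonal and divides no other radicand. Such a
matrix is invertible (`det_ne_zero_of_sq_eq_prime`): expanding along the first row, a zero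
determinant would put `√p` into a field generated by square roots of integers prime to `p`, which
adjoining one root at a time excludes.

A Chebyshev estimate gives on the order of `2 ^ d / d` primes in the dyadic interval. A maximal
family with distinct restrictions keeps at least a fraction `1 / (2 ^ |X| + 2 ^ (d - |X|))` of them,
so the size is at least of order `2 ^ (d / 3) / d`.

For the existence claims, `table` writes any function as a weighted sum of indicators of
assignments, and `digits` computes the prefix sums `1 + ∑ j ≤ i, 2 ^ j * v j` one digit at a time.
-/

/-! ### Primes in dyadic intervals -/

/-- The central binomial coefficient is bounded in terms of the number of primes in `(n, 2n]`. -/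
theorem Nat.centralBinom_le_of_card_primes (n : ℕ) (hn : 2 < n) :
    n.centralBinom ≤ (2 * n) ^ ((2 * n).sqrt + ((Finset.Ioc n (2 * n)).filter Nat.Prime).card) *
      4 ^ (2 * n / 3) := by
  have n2_pos : 1 ≤ 2 * n := by omega
  set f : ℕ → ℕ := fun p => p ^ n.centralBinom.factorization p with hf
  have hle : ∀ p, f p ≤ 2 * n := fun p => Nat.pow_factorization_choose_le (by omega)
  -- Primes in `(2n/3, n]` do not divide the central binomial coefficient, so `L` and `H` carry all
  -- its prime factors.
  set L := (Finset.range (2 * n / 3 + 1)).filter Nat.Prime with hL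
  set H := (Finset.Ioc n (2 * n)).filter Nat.Prime with hH
  have hdisj : Disjoint L H := by
    rw [Finset.disjoint_left]
    intro p hp hp'
    simp only [hL, hH, Finset.mem_filter, Finset.mem_range, Finset.mem_Ioc] at hp hp'
    omega
  have hprod : n.centralBinom = (∏ p ∈ L, f p) * ∏ p ∈ H, f p := by
    rw [← Finset.prod_union hdisj, ← n.prod_pow_factorization_centralBinom]
    symm
    apply Finset.prod_subset
    · intro p hp
      simp only [hL, hH, Finset.mem_union, Finset.mem_filter, Finset.mem_range,
        Finset.mem_Ioc] at hp ⊢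
      omega
    · intro p hp hp'
      simp only [hL, hH, Finset.mem_union, Finset.mem_filter, Finset.mem_range,
        Finset.mem_Ioc, not_or, not_and] at hp hp'
      by_cases hpp : p.Prime
      · have h1 : ¬ p < 2 * n / 3 + 1 := fun h => hp'.1 h hpp
        have h2 : p ≤ n := by
          by_contra h
          exact hp'.2 ⟨by omega, by omega⟩ hpp
        simp only [hf]
        rw [Nat.factorization_centralBinom_of_two_mul_self_lt_three_mul hn h2 (by omega),
          Nat.pow_zero]
      · simp only [hf]
        rw [ Nat.factorization_eq_zero_of_not_prime _ hpp, Nat.pow_zero]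
  have hHle : ∏ p ∈ H, f p ≤ (2 * n) ^ H.card := Finset.prod_le_pow_card _ _ _ fun p _ => hle p
  have hLle : ∏ p ∈ L, f p ≤ (2 * n) ^ (2 * n).sqrt * 4 ^ (2 * n / 3) := by
    -- Up to `√(2n)` there are few primes, each contributing at most `2n`; beyond it every exponent
    -- is at most one and the primorial bound applies.
    rw [← Finset.prod_filter_mul_prod_filter_not L (· ≤ (2 * n).sqrt)]
    apply mul_le_mul'
    · refine (Finset.prod_le_pow_card _ _ _ fun p _ => hle p).trans ?_
      refine Nat.pow_le_pow_right n2_pos ?_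
      have : (Finset.Icc 1 (2 * n).sqrt).card = (2 * n).sqrt := by simp
      refine (Finset.card_le_card fun x hx => ?_).trans this.le
      obtain ⟨h1, h2⟩ := Finset.mem_filter.1 hx
      exact Finset.mem_Icc.mpr ⟨(Finset.mem_filter.1 h1).2.one_lt.le, h2⟩
    · refine le_trans ?_ (primorial_le_four_pow (2 * n / 3))
      refine (Finset.prod_le_prod' fun p hp => (?_ : f p ≤ p)).trans ?_
      · obtain ⟨h1, h2⟩ := Finset.mem_filter.1 hp
        refine (pow_right_mono₀ (Finset.mem_filter.1 h1).2.one_lt.le ?_).trans (pow_one p).le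
        exact Nat.factorization_choose_le_one (Nat.sqrt_lt'.mp <| not_le.1 h2)
      · refine Finset.prod_le_prod_of_subset_of_one_le' (Finset.filter_subset _ _) ?_
        exact fun p hp _ => (Finset.mem_filter.1 hp).2.one_lt.le
  calc n.centralBinom ≤ ((2 * n) ^ (2 * n).sqrt * 4 ^ (2 * n / 3)) * (2 * n) ^ H.card := by
        rw [hprod]; exact Nat.mul_le_mul hLle hHle
    _ = _ := by rw [pow_add]; ring

/-- Dyadic intervals contain many primes. -/
theorem two_pow_le_card_primes (d : ℕ) (hd : 4 ≤ d) :
    2 ^ d ≤ 3 * (d * (1 + (2 ^ d).sqrt +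
      ((Finset.Ioc (2 ^ (d - 1)) (2 ^ d)).filter Nat.Prime).card)) := by
  obtain ⟨e, rfl⟩ : ∃ e, d = e + 1 := ⟨d - 1, by omega⟩
  have h8 : 8 ≤ 2 ^ e := by
    calc 8 = 2 ^ 3 := rfl
      _ ≤ 2 ^ e := Nat.pow_le_pow_right (by norm_num) (by omega)
  have hb := Nat.centralBinom_le_of_card_primes (2 ^ e) (by omega)
  have h4 := Nat.four_pow_lt_mul_centralBinom (2 ^ e) (by omega)
  simp only [Nat.add_sub_cancel]
  rw [← pow_succ'] at hb
  set s := (2 ^ (e + 1)).sqrt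
  set c := ((Finset.Ioc (2 ^ e) (2 ^ (e + 1))).filter Nat.Prime).card
  -- With everything a power of 2, the exponents can be compared: the primes up to `2n/3` account
  -- for only two thirds of `2 ^ (e + 1)`.
  have h : 2 ^ (2 * 2 ^ e) < 2 ^ (e + (e + 1) * (s + c) + 2 * (2 ^ (e + 1) / 3)) := by
    calc 2 ^ (2 * 2 ^ e) = 4 ^ 2 ^ e := by rw [pow_mul]; norm_num
      _ < 2 ^ e * (2 ^ e).centralBinom := h4
      _ ≤ 2 ^ e * ((2 ^ (e + 1)) ^ (s + c) * 4 ^ (2 ^ (e + 1) / 3)) := Nat.mul_le_mul_left _ hb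
      _ = _ := by
        rw [show (4 : ℕ) = 2 ^ 2 by norm_num, ← pow_mul, ← pow_mul, ← pow_add, ← pow_add, add_assoc]
  have h' := (Nat.pow_lt_pow_iff_right (by norm_num : 1 < 2)).1 h
  have h2 : 2 * 2 ^ e = 2 ^ (e + 1) := by rw [pow_succ']
  have : (e + 1) * (1 + s + c) = (e + 1) * (s + c) + (e + 1) := by ring
  omega

/-! ### Square roots and real fields -/

/-- No square root of a natural number with odd `p`-adic valuation lies in `K`. -/
def OddSqrtFree (p : ℕ) (K : Subfield ℝ) : Prop :=
  ∀ N : ℕ, Odd (padicValNat p N) → √(N : ℝ) ∉ K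

/-- A rational `√N` forces `N` to be a perfect square, whose valuations are even. -/
theorem oddSqrtFree_bot (p : ℕ) [Fact p.Prime] : OddSqrtFree p ⊥ := by
  intro N hN h
  have hirr : ¬ Irrational √(N : ℝ) := by
    rw [Subfield.bot_eq_of_charZero] at h
    obtain ⟨q, hq⟩ := h
    exact fun hi => hi ⟨q, by simpa using hq⟩
  rw [irrational_sqrt_natCast_iff, not_not] at hirr
  obtain ⟨r, rfl⟩ := hirr
  rcases eq_or_ne r 0 with rfl | hr
  · simp at hN
  · rw [padicValNat.mul hr hr] at hN
    exact (Nat.not_odd_iff_even.2 ⟨_, rfl⟩) hN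

/-- The quadratic extension of a real subfield by a square root that it does not contain. -/
def quadraticExtension (K : Subfield ℝ) (s : ℝ) (hs : s ^ 2 ∈ K) (hs' : s ∉ K) : Subfield ℝ where
  carrier := {x | ∃ u ∈ K, ∃ v ∈ K, x = u + v * s}
  zero_mem' := ⟨0, K.zero_mem, 0, K.zero_mem, by simp⟩
  one_mem' := ⟨1, K.one_mem, 0, K.zero_mem, by simp⟩
  add_mem' := by
    rintro _ _ ⟨u, hu, v, hv, rfl⟩ ⟨u', hu', v', hv', rfl⟩
    exact ⟨u + u', K.add_mem hu hu', v + v', K.add_mem hv hv', by ring⟩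
  neg_mem' := by
    rintro _ ⟨u, hu, v, hv, rfl⟩
    exact ⟨-u, K.neg_mem hu, -v, K.neg_mem hv, by ring⟩
  mul_mem' := by
    rintro _ _ ⟨u, hu, v, hv, rfl⟩ ⟨u', hu', v', hv', rfl⟩
    exact ⟨u * u' + v * v' * s ^ 2,
      K.add_mem (K.mul_mem hu hu') (K.mul_mem (K.mul_mem hv hv') hs), u * v' + v * u',
      K.add_mem (K.mul_mem hu hv') (K.mul_mem hv hu'), by ring⟩
  inv_mem' := by
    rintro _ ⟨u, hu, v, hv, rfl⟩
    rcases eq_or_ne v 0 with rfl | hv0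
    · exact ⟨u⁻¹, K.inv_mem hu, 0, K.zero_mem, by simp⟩
    have hne : ∀ w ∈ K, w + v * s ≠ 0 := by
      intro w hw h
      apply hs'
      have : s = -w / v := by field_simp; linarith
      rw [this]
      exact K.div_mem (K.neg_mem hw) hv
    have h1 := hne u hu
    have h2 : u - v * s ≠ 0 := by
      intro h
      exact hne (-u) (K.neg_mem hu) (by linarith)
    have hD : u ^ 2 - v ^ 2 * s ^ 2 ≠ 0 := by
      have : u ^ 2 - v ^ 2 * s ^ 2 = (u + v * s) * (u - v * s) := by ring
      rw [this]
      exact mul_ne_zero h1 h2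
    have hDK : u ^ 2 - v ^ 2 * s ^ 2 ∈ K :=
      K.sub_mem (K.pow_mem hu 2) (K.mul_mem (K.pow_mem hv 2) hs)
    refine ⟨u / (u ^ 2 - v ^ 2 * s ^ 2), K.div_mem hu hDK, -v / (u ^ 2 - v ^ 2 * s ^ 2),
      K.div_mem (K.neg_mem hv) hDK, ?_⟩
    field_simp
    ring

/-- Suppose `√N = u + v√a` with `√a ∉ K`. Squaring gives `u * v = 0`, since otherwise `√a` could be
solved for in `K`. If `v = 0`, then `√N ∈ K`; if `u = 0`, then `√(N * a) = v * a ∈ K`, and `N * a`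
has the same `p`-adic valuation as `N`. Tracking all `N` of odd valuation, and not just `p`, is what
makes the induction close. -/
theorem OddSqrtFree.adjoin {p : ℕ} [Fact p.Prime] {K : Subfield ℝ} (hK : OddSqrtFree p K)
    {a : ℕ} (ha : ¬ p ∣ a) :
    ∃ L : Subfield ℝ, K ≤ L ∧ OddSqrtFree p L ∧ √(a : ℝ) ∈ L := by
  by_cases has : √(a : ℝ) ∈ K
  · exact ⟨K, le_rfl, hK, has⟩
  have ha2 : √(a : ℝ) ^ 2 = a := Real.sq_sqrt (Nat.cast_nonneg a)
  have ha0 : a ≠ 0 := by rintro rfl; simp at ha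
  refine ⟨quadraticExtension K √(a : ℝ) (by rw [ha2]; exact natCast_mem K a) has,
    fun x hx => ⟨x, hx, 0, K.zero_mem, by simp⟩, ?_, ⟨0, K.zero_mem, 1, K.one_mem, by simp⟩⟩
  rintro N hN ⟨u, hu, v, hv, h⟩
  have hN0 : N ≠ 0 := by rintro rfl; simp at hN
  have hsq : (N : ℝ) = u ^ 2 + v ^ 2 * a + 2 * u * v * √(a : ℝ) := by
    rw [← Real.sq_sqrt (Nat.cast_nonneg N), h, ← ha2]
    simp only [Real.sqrt_sq (Real.sqrt_nonneg _)]
    ring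
  have huv : u * v = 0 := by
    by_contra huv
    apply has
    have : √(a : ℝ) = (N - u ^ 2 - v ^ 2 * a) / (2 * (u * v)) := by
      rw [eq_div_iff (by simpa using huv)]
      linarith
    rw [this]
    have hn : ∀ n : ℕ, (n : ℝ) ∈ K := natCast_mem K
    exact K.div_mem (K.sub_mem (K.sub_mem (hn N) (K.pow_mem hu 2))
      (K.mul_mem (K.pow_mem hv 2) (hn a))) (K.mul_mem (by exact_mod_cast hn 2) (K.mul_mem hu hv))
  rcases mul_eq_zero.1 huv with rfl | rfl
  · refine hK (N * a) ?_ ?_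
    · rw [padicValNat.mul hN0 ha0, padicValNat.eq_zero_of_not_dvd ha, add_zero]
      exact hN
    · rw [Nat.cast_mul, Real.sqrt_mul (Nat.cast_nonneg N), h]
      have : (0 + v * √(a : ℝ)) * √(a : ℝ) = v * a := by rw [← ha2]; ring_nf; simp
      rw [this]
      exact K.mul_mem hv (natCast_mem K a)
  · exact hK N hN (by rw [h]; simpa using hu)

theorem exists_oddSqrtFree (p : ℕ) [Fact p.Prime] (S : Finset ℕ) (hS : ∀ a ∈ S, ¬ p ∣ a) :
    ∃ K : Subfield ℝ, OddSqrtFree p K ∧ ∀ a ∈ S, √(a : ℝ) ∈ K := by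
  induction S using Finset.induction_on with
  | empty => exact ⟨⊥, oddSqrtFree_bot p, by simp⟩
  | insert a S _ ih =>
    obtain ⟨K, hK, hKS⟩ := ih fun b hb => hS b (Finset.mem_insert_of_mem hb)
    obtain ⟨L, hKL, hL, haL⟩ := hK.adjoin (hS a (Finset.mem_insert_self a S))
    refine ⟨L, hL, fun b hb => ?_⟩
    rcases Finset.mem_insert.1 hb with rfl | hb
    · exact haL
    · exact hKL (hKS b hb)

theorem Subfield.det_mem (K : Subfield ℝ) {n : ℕ} (M : Matrix (Fin n) (Fin n) ℝ)
    (h : ∀ i j, M i j ∈ K) : M.det ∈ K := by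
  rw [Matrix.det_apply]
  refine K.sum_mem fun σ _ => ?_
  have hp : ∏ i, M (σ i) i ∈ K := K.prod_mem fun i _ => h _ _
  rcases Int.units_eq_one_or (Equiv.Perm.sign σ) with hσ | hσ <;> rw [hσ]
  · simpa using hp
  · simpa using hp

/-- A matrix of square roots with primes on the diagonal that divide no other entry's square is
invertible. -/
theorem det_ne_zero_of_sq_eq_prime :
    ∀ (n : ℕ) (M : Matrix (Fin n) (Fin n) ℝ) (m : Fin n → Fin n → ℕ),
      (∀ i j, M i j ^ 2 = m i j) → (∀ i, (m i i).Prime) →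
      (∀ l i j, m l l ∣ m i j → i = l ∧ j = l) → M.det ≠ 0 := by
  intro n
  induction n with
  | zero => intro M m _ _ _; simp
  | succ n ih =>
    intro M m hM hp hd hdet
    have hminor := ih (M.submatrix Fin.succ Fin.succ) (fun i j => m i.succ j.succ)
      (fun i j => hM _ _) (fun i => hp _) fun l i j h => by
        simpa using hd _ _ _ h
    have : Fact (m 0 0).Prime := ⟨hp 0⟩
    -- `K` contains the square roots of all radicands except the one in the corner, hence all the
    -- other entries, whatever their signs.
    obtain ⟨K, hK, hKS⟩ := exists_oddSqrtFree (m 0 0)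
      ((Finset.univ.filter fun q : Fin (n + 1) × Fin (n + 1) => q ≠ 0).image fun q => m q.1 q.2)
      (by
        intro a ha hda
        obtain ⟨q, hq, rfl⟩ := Finset.mem_image.1 ha
        have := hd 0 _ _ hda
        exact (Finset.mem_filter.1 hq).2 (Prod.ext this.1 this.2))
    have hmem : ∀ i j, (i, j) ≠ (0 : Fin (n + 1) × Fin (n + 1)) → M i j ∈ K := by
      intro i j hij
      have h1 : √(m i j : ℝ) ∈ K :=
        hKS _ (Finset.mem_image.2 ⟨(i, j), by simpa using hij, rfl⟩)
      rw [← hM, Real.sqrt_sq_eq_abs] at h1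
      rcases abs_choice (M i j) with h | h <;> rw [h] at h1
      · exact h1
      · simpa using h1
    have hmem' : ∀ i : Fin n, ∀ j, M i.succ j ∈ K := fun i j =>
      hmem _ _ fun h => Fin.succ_ne_zero i (congrArg Prod.fst h)
    -- If the determinant vanished, the expansion along row 0 could be solved for the corner entry,
    -- its cofactor being nonzero by induction.
    have h00 : M 0 0 ∈ K := by
      rw [Matrix.det_succ_row_zero, Fin.sum_univ_succ] at hdet
      simp only [Fin.val_zero, pow_zero, one_mul] at hdet
      rw [eq_div_of_mul_eq hminor (eq_neg_of_add_eq_zero_left hdet)]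
      refine K.div_mem (K.neg_mem (K.sum_mem fun j _ => ?_)) ?_
      · refine K.mul_mem (K.mul_mem (K.pow_mem (K.neg_mem K.one_mem) _) (hmem _ _ fun h =>
          Fin.succ_ne_zero j (congrArg Prod.snd h))) ?_
        exact K.det_mem _ fun i j => hmem' _ _
      · exact K.det_mem _ fun i j => hmem' _ _
    refine hK (m 0 0) (by simp) ?_
    rw [← hM, Real.sqrt_sq_eq_abs]
    rcases abs_choice (M 0 0) with h | h <;> rw [h]
    · exact h00
    · simpa using h00

/-! ### Balanced cuts of structured-decomposable circuits -/

/-- Among numbers of size at most `2d/3` with sum at least `d/3`, some have sum in `[d/3, 2d/3]`. -/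
theorem Finset.exists_subset_sum_balanced {β : Type*} [DecidableEq β] (w : β → ℕ) (d : ℕ)
    (s : Finset β) (hw : ∀ b ∈ s, 3 * w b ≤ 2 * d) (hs : d ≤ 3 * ∑ b ∈ s, w b) :
    ∃ t ⊆ s, d ≤ 3 * ∑ b ∈ t, w b ∧ 3 * ∑ b ∈ t, w b ≤ 2 * d := by
  induction s using Finset.induction_on with
  | empty => exact ⟨∅, subset_rfl, hs, by simp⟩
  | insert b s hb ih =>
    by_cases h : d ≤ 3 * ∑ b ∈ s, w b
    · obtain ⟨t, hts, ht⟩ := ih (fun c hc => hw c (Finset.mem_insert_of_mem hc)) h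
      exact ⟨t, hts.trans (Finset.subset_insert _ _), ht⟩
    -- The total over `s` is below `d/3`: either `b` alone is in range, or adding its weight, also
    -- below `d/3`, stays under `2d/3`.
    · by_cases hwb : d ≤ 3 * w b
      · exact ⟨{b}, by simp, by simpa using hwb, by simpa using hw b (Finset.mem_insert_self _ _)⟩
      · refine ⟨insert b s, subset_rfl, hs, ?_⟩
        rw [Finset.sum_insert hb]
        omega

namespace PC

variable {ι α : Type}

instance instFintypeNode (C : PC ι α) : Fintype C.Node := C.fin

theorem exists_mem_inp (C : PC ι α) {n : C.Node} (h : ¬ (C.node n).IsInput) :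
    ∃ m, m ∈ C.inp n :=
  Finset.nonempty_iff_ne_empty.2 fun he => h ((C.leaf_iff n).1 he)

theorem not_isInput_of_mem_inp (C : PC ι α) {m n : C.Node} (h : m ∈ C.inp n) :
    ¬ (C.node n).IsInput := fun hi => by
  rw [(C.leaf_iff n).2 hi] at h
  simp at h

/-- Every node other than the root lies on a path to the root, so it is an input of some node and is
counted by an edge. -/
theorem card_node_le (C : PC ι α) : Fintype.card C.Node ≤ C.size + 1 := by
  classical
  have h : (Finset.univ : Finset C.Node) ⊆ insert C.root (Finset.univ.biUnion C.inp) := by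
    intro n _
    rcases (C.rooted n).cases_head with h | ⟨m, hm, _⟩
    · exact Finset.mem_insert.2 (Or.inl h)
    · exact Finset.mem_insert_of_mem (Finset.mem_biUnion.2 ⟨m, Finset.mem_univ _, hm⟩)
  calc Fintype.card C.Node ≤ (insert C.root (Finset.univ.biUnion C.inp)).card :=
        Finset.card_le_card h
    _ ≤ (Finset.univ.biUnion C.inp).card + 1 := Finset.card_insert_le _ _
    _ ≤ C.size + 1 := Nat.add_le_add_right Finset.card_biUnion_le 1

theorem dependsOn_mul {s : Set ι} {f g : (ι → α) → ℝ} (hf : DependsOn f s) (hg : DependsOn g s) :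
    DependsOn (fun x => f x * g x) s := fun x y h => by simp only [hf h, hg h]

theorem dependsOn_prod {κ : Type} {s : Set ι} {t : Finset κ} {f : κ → (ι → α) → ℝ}
    (hf : ∀ i ∈ t, DependsOn (f i) s) : DependsOn (fun x => ∏ i ∈ t, f i x) s :=
  fun _ _ h => Finset.prod_congr rfl fun i hi => hf i hi h

theorem nodeFun_of_isProd {C : PC ι α} {n : C.Node} (hn : (C.node n).IsProd) (x : ι → α) :
    C.nodeFun n x = ∏ m ∈ C.inp n, C.nodeFun m x := by
  rw [C.nodeFun_eq]
  cases hnode : C.node n with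
  | prod => rfl
  | input W f => simp [hnode, PCNode.IsProd] at hn
  | sum θ => simp [hnode, PCNode.IsProd] at hn

theorem not_isInput_of_isProd {C : PC ι α} {n : C.Node} (hn : (C.node n).IsProd) : ¬ (C.node n).IsInput := by
  cases hnode : C.node n <;> simp_all [PCNode.IsProd, PCNode.IsInput]

/-- `f` is a combination of the functions `a P` whose coefficients do not depend on the variables
in `X`. -/
def InSpan (C : PC ι α) (a : C.Node → (ι → α) → ℝ) (X : Finset ι) (f : (ι → α) → ℝ) : Prop :=
  ∃ h : C.Node → (ι → α) → ℝ, (∀ P, DependsOn (h P) ((X : Set ι)ᶜ)) ∧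
    ∀ x, f x = ∑ P, a P x * h P x

theorem InSpan.mul {C : PC ι α} {a : C.Node → (ι → α) → ℝ} {X : Finset ι} {f g : (ι → α) → ℝ}
    (hf : C.InSpan a X f) (hg : DependsOn g ((X : Set ι)ᶜ)) : C.InSpan a X fun x => f x * g x := by
  obtain ⟨h, hh, hfh⟩ := hf
  refine ⟨fun P x => h P x * g x, fun P => dependsOn_mul (hh P) hg, fun x => ?_⟩
  simp only [hfh, Finset.sum_mul]
  exact Finset.sum_congr rfl fun P _ => mul_assoc _ _ _

theorem InSpan.sum {C : PC ι α} {a : C.Node → (ι → α) → ℝ} {X : Finset ι} {κ : Type} (s : Finset κ)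
    (θ : κ → ℝ) {f : κ → (ι → α) → ℝ} (hf : ∀ i ∈ s, C.InSpan a X (f i)) :
    C.InSpan a X fun x => ∑ i ∈ s, θ i * f i x := by
  choose! h hh hfh using hf
  refine ⟨fun P x => ∑ i ∈ s, θ i * h i P x, fun P x y hxy => ?_, fun x => ?_⟩
  · exact Finset.sum_congr rfl fun i hi => by rw [hh i hi P hxy]
  · simp_rw [Finset.mul_sum]
    rw [Finset.sum_comm]
    refine Finset.sum_congr rfl fun i hi => ?_
    rw [hfh i hi, Finset.mul_sum]
    exact Finset.sum_congr rfl fun P _ => mul_left_comm _ _ _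

section Scope

variable [DecidableEq ι] (C : PC ι α)

theorem scope_of_not_isInput {n : C.Node} (h : ¬ (C.node n).IsInput) :
    C.scope n = (C.inp n).biUnion C.scope := by
  rw [C.scope_eq]
  cases hn : C.node n with
  | input W f => simp [hn, PCNode.IsInput] at h
  | prod => rfl
  | sum θ => rfl

theorem scope_subset_of_mem_inp {m n : C.Node} (h : m ∈ C.inp n) : C.scope m ⊆ C.scope n := by
  rw [C.scope_of_not_isInput (C.not_isInput_of_mem_inp h)]
  exact Finset.subset_biUnion_of_mem _ h

variable {C}

theorem Smooth.scope_eq_of_mem_inp (hC : C.Smooth) {m n : C.Node} (hn : (C.node n).IsSum)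
    (h : m ∈ C.inp n) : C.scope m = C.scope n := by
  rw [C.scope_of_not_isInput (C.not_isInput_of_mem_inp h)]
  ext i
  rw [Finset.mem_biUnion]
  exact ⟨fun hi => ⟨m, h, hi⟩, fun ⟨m', hm', hi⟩ => hC n hn m h m' hm' ▸ hi⟩

theorem InputArityLE.not_isInput {k : ℕ} (hC : C.InputArityLE k) {n : C.Node}
    (h : k < (C.scope n).card) : ¬ (C.node n).IsInput := by
  have h1 := hC n
  rw [C.scope_eq] at h
  cases hn : C.node n with
  | input W f =>
    rw [hn] at h1 h
    exact absurd h1 (not_le.2 h)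
  | prod => exact id
  | sum θ => exact id

variable (C) in
theorem nodeFun_dependsOn (n : C.Node) : DependsOn (C.nodeFun n) (C.scope n : Set ι) := by
  induction n using C.wf.induction with
  | _ n ih =>
    intro x y hxy
    have hm : ∀ m ∈ C.inp n, C.nodeFun m x = C.nodeFun m y := fun m hm =>
      ih m hm fun i hi => hxy i (C.scope_subset_of_mem_inp hm hi)
    rw [C.scope_eq] at hxy
    rw [C.nodeFun_eq, C.nodeFun_eq]
    cases hn : C.node n with
    | input W f =>
      rw [hn] at hxy
      exact congrArg f (funext fun i => hxy i i.2)
    | prod => exact Finset.prod_congr rfl hm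
    | sum θ => exact Finset.sum_congr rfl fun m h => by rw [hm m h]

/-- Below a node of large scope there is a product node with the same scope that splits it. -/
theorem exists_splitting_prod (hC : C.Smooth) {k : ℕ} (hk : C.InputArityLE k) (n : C.Node)
    (hn : k < (C.scope n).card) :
    ∃ P, (C.node P).IsProd ∧ C.scope P = C.scope n ∧ ∀ m ∈ C.inp P, C.scope m ≠ C.scope n := by
  induction n using C.wf.induction with
  | _ n ih =>
    have hni := hk.not_isInput hn
    by_cases h : ∃ m ∈ C.inp n, C.scope m = C.scope n
    · obtain ⟨m, hm, hmn⟩ := h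
      obtain ⟨P, hP⟩ := ih m hm (by rwa [hmn])
      exact ⟨P, by rwa [hmn] at hP⟩
    · push Not at h
      cases hnode : C.node n with
      | input W f => simp [hnode, PCNode.IsInput] at hni
      | prod => exact ⟨n, by simp [hnode, PCNode.IsProd], rfl, h⟩
      | sum θ =>
        obtain ⟨m, hm⟩ := C.exists_mem_inp hni
        exact absurd (hC.scope_eq_of_mem_inp (by simp [hnode, PCNode.IsSum]) hm) (h m hm)

/-- A node of scope `Z` is not an input node because `k < Z.card`, and by smoothness the inputs of a
sum node of scope `Z` again have scope `Z`. Descending through sums thus only ends at product nodes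
of scope `Z`. -/
theorem inSpan_of_prod (hC : C.Smooth) {k : ℕ} (hk : C.InputArityLE k)
    {a : C.Node → (ι → α) → ℝ} {X Z : Finset ι} (hZ : k < Z.card)
    (hP : ∀ n, (C.node n).IsProd → C.scope n = Z → C.InSpan a X (C.nodeFun n))
    (n : C.Node) (hn : C.scope n = Z) : C.InSpan a X (C.nodeFun n) := by
  induction n using C.wf.induction with
  | _ n ih =>
    cases hnode : C.node n with
    | input W f =>
      exact absurd (by simp [hnode, PCNode.IsInput]) (hk.not_isInput (hn.symm ▸ hZ))
    | prod => exact hP n (by simp [hnode, PCNode.IsProd]) hn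
    | sum θ =>
      have h := InSpan.sum (C.inp n) θ fun m hm => ih m hm
        ((hC.scope_eq_of_mem_inp (by simp [hnode, PCNode.IsSum]) hm).trans hn)
      convert h using 1
      ext x
      rw [C.nodeFun_eq, hnode]

theorem dependsOn_compl {n : C.Node} {X : Finset ι} (h : Disjoint (C.scope n) X) :
    DependsOn (C.nodeFun n) ((X : Set ι)ᶜ) := fun _ _ hxy =>
  C.nodeFun_dependsOn n fun i hi => hxy i fun hX => Finset.disjoint_left.1 h hi hX

/-- All nodes of a given large scope factor along one balanced cut, through at most as many
functions as there are nodes. -/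
theorem exists_balanced_cut (hC : C.StructuredDecomposable) {k : ℕ} (hk : C.InputArityLE k)
    (d : ℕ) (hkd : 3 * k ≤ 2 * d) (Z : Finset ι) (hZ : 2 * d < 3 * Z.card)
    (hZn : ∃ n, C.scope n = Z) :
    ∃ X ⊆ Z, d ≤ 3 * X.card ∧ 3 * X.card ≤ 2 * d ∧ ∃ a : C.Node → (ι → α) → ℝ,
      (∀ P, DependsOn (a P) (X : Set ι)) ∧
      ∀ n, C.scope n = Z → C.InSpan a X (C.nodeFun n) := by
  classical
  obtain ⟨hsm, hdec, hst⟩ := hC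
  induction Z using Finset.strongInduction with
  | H Z ih =>
    obtain ⟨n₀, rfl⟩ := hZn
    obtain ⟨P₀, hP₀, hsc₀, hsplit⟩ := exists_splitting_prod hsm hk n₀ (by omega)
    -- If some input still has scope above `2d/3`, recurse into it: every product node of scope `Z`
    -- has an input with that same scope, and its other inputs do not meet `X`, so they are absorbed
    -- into the coefficients.
    by_cases hbig : ∃ m ∈ C.inp P₀, 2 * d < 3 * (C.scope m).card
    · obtain ⟨m₀, hm₀, hm₀d⟩ := hbig
      have hsub : C.scope m₀ ⊂ C.scope n₀ :=
        lt_of_le_of_ne (hsc₀ ▸ C.scope_subset_of_mem_inp hm₀) (hsplit m₀ hm₀)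
      obtain ⟨X, hX, hX1, hX2, a, ha, hspan⟩ := ih _ hsub hm₀d ⟨m₀, rfl⟩
      refine ⟨X, hX.trans hsub.1, hX1, hX2, a, ha, inSpan_of_prod hsm hk (by omega) ?_⟩
      intro n hn hnZ
      have hmem : C.scope m₀ ∈ C.blocks P₀ :=
        ⟨Finset.card_pos.1 (by omega), m₀, hm₀, rfl⟩
      rw [hst P₀ n hP₀ hn (hsc₀.trans hnZ.symm)] at hmem
      obtain ⟨-, m, hm, hmm₀⟩ := hmem
      have h := (hspan m hmm₀).mul (g := fun x => ∏ m' ∈ (C.inp n).erase m, C.nodeFun m' x)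
        (dependsOn_prod fun m' hm' => dependsOn_compl <|
          (hdec n hn m' (Finset.mem_of_mem_erase hm') m hm
            (Finset.ne_of_mem_erase hm')).mono_right (hmm₀ ▸ hX))
      convert h using 1
      ext x
      rw [nodeFun_of_isProd hn]
      exact (Finset.mul_prod_erase _ (fun m => C.nodeFun m x) hm).symm
    · push Not at hbig
      have hcard : ∀ T ⊆ C.inp P₀, (T.biUnion C.scope).card = ∑ m ∈ T, (C.scope m).card :=
        fun T hT => Finset.card_biUnion fun m hm m' hm' => hdec P₀ hP₀ m (hT hm) m' (hT hm')
      have htot := hcard _ subset_rfl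
      rw [← C.scope_of_not_isInput (not_isInput_of_isProd hP₀), hsc₀] at htot
      -- All blocks now have at most `2d/3` variables, so a union of some of them serves as the
      -- balanced set `X`.
      obtain ⟨T, hT, hT1, hT2⟩ := Finset.exists_subset_sum_balanced
        (fun m => (C.scope m).card) d (C.inp P₀) hbig (by omega)
      rw [← hcard T hT] at hT1 hT2
      set X := T.biUnion C.scope with hX
      have hXZ : X ⊆ C.scope n₀ := by
        rw [hX, Finset.biUnion_subset, ← hsc₀]
        exact fun m hm => C.scope_subset_of_mem_inp (hT hm)
      -- Every product node of scope `Z` has the blocks of `P₀`, so each of its inputs falls on one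
      -- side of `X`. Inputs of empty scope, which are not blocks, count as inside `X`.
      have hdich : ∀ n, (C.node n).IsProd → C.scope n = C.scope n₀ → ∀ m ∈ C.inp n,
          ¬ C.scope m ⊆ X → Disjoint (C.scope m) X := by
        intro n hn hnZ m hm hmX
        have hmem : C.scope m ∈ C.blocks n := by
          refine ⟨Finset.nonempty_iff_ne_empty.2 fun h => hmX ?_, m, hm, rfl⟩
          rw [h]
          exact Finset.empty_subset _
        rw [hst n P₀ hn hP₀ (hnZ.trans hsc₀.symm)] at hmem
        obtain ⟨-, m', hm', hmm'⟩ := hmem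
        rw [← hmm'] at hmX ⊢
        have hm'T : m' ∉ T := fun h => hmX (Finset.subset_biUnion_of_mem C.scope h)
        rw [hX, Finset.disjoint_biUnion_right]
        exact fun q hq => hdec P₀ hP₀ m' hm' q (hT hq) fun h => hm'T (h ▸ hq)
      refine ⟨X, hXZ, hT1, hT2,
        fun P x => ∏ m ∈ (C.inp P).filter (C.scope · ⊆ X), C.nodeFun m x,
        fun P => dependsOn_prod fun m hm x y hxy => C.nodeFun_dependsOn m fun i hi =>
          hxy i ((Finset.mem_filter.1 hm).2 hi),
        inSpan_of_prod hsm hk (by omega) ?_⟩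
      intro n hn hnZ
      -- A product node `n` needs a single term: its inputs inside `X` form `a n`, the remaining
      -- ones its coefficient.
      refine ⟨fun P x => if P = n then
        ∏ m ∈ (C.inp n).filter (¬ C.scope · ⊆ X), C.nodeFun m x else 0, fun P => ?_, fun x => ?_⟩
      · by_cases hPn : P = n
        · simp only [hPn, if_true]
          exact dependsOn_prod fun m hm => dependsOn_compl <|
            hdich n hn hnZ m (Finset.mem_filter.1 hm).1 (Finset.mem_filter.1 hm).2
        · simp only [hPn, if_false]
          exact fun _ _ _ => rfl
      · simp only [mul_ite, mul_zero, Finset.sum_ite_eq', Finset.mem_univ, if_true]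
        rw [nodeFun_of_isProd hn, Finset.prod_filter_mul_prod_filter_not]

end Scope

/-- The assignment that agrees with `x` on `X` and with `y` elsewhere. -/
def merge [DecidableEq ι] (X : Finset ι) (x y : ι → α) : ι → α := fun i => if i ∈ X then x i else y i

/-- The matrix factors through a space indexed by the nodes, rows depending only on the part in `X`
and columns only on the part outside it. Being invertible, it has rank `s`. -/
theorem InSpan.le_card_node [DecidableEq ι] {C : PC ι α} {a : C.Node → (ι → α) → ℝ}
    {X : Finset ι} (ha : ∀ P, DependsOn (a P) (X : Set ι)) {f : (ι → α) → ℝ}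
    (hf : C.InSpan a X f) {s : ℕ} (v : Fin s → ι → α)
    (hdet : (Matrix.of fun i j => f (merge X (v i) (v j))).det ≠ 0) :
    s ≤ Fintype.card C.Node := by
  obtain ⟨h, hh, hfh⟩ := hf
  have hmul : (Matrix.of fun i j => f (merge X (v i) (v j))) =
      (Matrix.of fun i P => a P (v i)) * Matrix.of fun P j => h P (v j) := by
    ext i j
    rw [Matrix.mul_apply, Matrix.of_apply, hfh]
    refine Finset.sum_congr rfl fun P _ => ?_
    simp only [Matrix.of_apply]
    congr 1
    · exact ha P fun i hi => if_pos hi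
    · exact hh P fun i hi => if_neg hi
  have hr := Matrix.rank_of_isUnit _ ((Matrix.isUnit_iff_isUnit_det _).2 (isUnit_iff_ne_zero.2 hdet))
  rw [Fintype.card_fin] at hr
  calc s = _ := hr.symm
    _ ≤ _ := by rw [hmul]; exact Matrix.rank_mul_le_left _ _
    _ ≤ Fintype.card C.Node := Matrix.rank_le_card_width _

end PC

/-! ### Binary digits and matchings across a cut -/

theorem binaryValue_succ {d : ℕ} (v : Fin (d + 1) → Bool) :
    binaryValue v = (if v 0 then 1 else 0) + 2 * binaryValue (fun i => v i.succ) := by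
  unfold binaryValue
  rw [Fin.sum_univ_succ, Finset.mul_sum]
  congr 1
  refine Finset.sum_congr rfl fun i _ => ?_
  split_ifs <;> simp [pow_succ']

theorem binaryValue_lt : ∀ {d : ℕ} (v : Fin d → Bool), binaryValue v < 2 ^ d
  | 0, v => by simp [binaryValue]
  | d + 1, v => by
    have h := binaryValue_lt fun i => v i.succ
    rw [binaryValue_succ, pow_succ]
    split_ifs <;> omega

theorem binaryValue_injective : ∀ d : ℕ, Function.Injective (binaryValue (d := d))
  | 0 => fun _ _ _ => Subsingleton.elim _ _
  | d + 1 => fun u v h => by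
    rw [binaryValue_succ, binaryValue_succ] at h
    have h0 : u 0 = v 0 := by
      cases hu : u 0 <;> cases hv : v 0 <;> simp [hu, hv] at h ⊢ <;> omega
    have hs : (fun i => u (Fin.succ i)) = fun i => v (Fin.succ i) :=
      binaryValue_injective d (by rw [h0] at h; omega)
    ext i
    refine Fin.cases ?_ (fun j => ?_) i
    · rw [h0]
    · rw [congrFun hs j]

theorem exists_binaryValue_eq : ∀ (d n : ℕ), n < 2 ^ d → ∃ v : Fin d → Bool, binaryValue v = n
  | 0, n, h => ⟨fun _ => false, by simp [binaryValue] at h ⊢; omega⟩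
  | d + 1, n, h => by
    obtain ⟨v, hv⟩ := exists_binaryValue_eq d (n / 2) (by rw [pow_succ] at h; omega)
    refine ⟨Fin.cons (decide (n % 2 = 1)) v, ?_⟩
    rw [binaryValue_succ]
    simp only [Fin.cons_zero, Fin.cons_succ, decide_eq_true_eq, hv]
    split_ifs <;> omega

theorem card_agree_le {d : ℕ} (S : Finset (Fin d)) (q : Fin d → Bool) :
    (Finset.univ.filter fun v : Fin d → Bool => ∀ i ∈ S, q i = v i).card ≤ 2 ^ (d - S.card) := by
  have hc : Sᶜ.powerset.card = 2 ^ (d - S.card) := by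
    rw [Finset.card_powerset, Finset.card_compl, Fintype.card_fin]
  rw [← hc]
  refine Finset.card_le_card_of_injOn (fun v => Sᶜ.filter fun i => v i = true)
    (fun v _ => Finset.mem_coe.2 <| Finset.mem_powerset.2 <| Finset.filter_subset _ _) ?_
  intro u hu v hv huv
  ext i
  by_cases hi : i ∈ S
  · rw [← (Finset.mem_filter.1 hu).2 i hi, ← (Finset.mem_filter.1 hv).2 i hi]
  · have := Finset.ext_iff.1 huv i
    simp only [Finset.mem_filter, Finset.mem_compl, hi, not_false_eq_true, true_and] at this
    rw [Bool.eq_iff_iff, this]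

/-- A large family of assignments with pairwise distinct restrictions to both sides of a cut. -/
theorem exists_large_matching {d : ℕ} (X : Finset (Fin d)) (F : Finset (Fin d → Bool)) :
    ∃ Q ⊆ F, (∀ u ∈ Q, ∀ v ∈ Q, (∀ i ∈ X, u i = v i) → u = v) ∧
      (∀ u ∈ Q, ∀ v ∈ Q, (∀ i ∈ Xᶜ, u i = v i) → u = v) ∧
      F.card ≤ Q.card * (2 ^ X.card + 2 ^ (d - X.card)) := by
  classical
  let good : (Finset (Fin d → Bool)) → Prop := fun Q =>
    ∀ u ∈ Q, ∀ v ∈ Q, ((∀ i ∈ X, u i = v i) ∨ ∀ i ∈ Xᶜ, u i = v i) → u = v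
  obtain ⟨Q, hQ, hmax⟩ := Finset.exists_max_image (F.powerset.filter good) Finset.card
    ⟨∅, by simp [good]⟩
  obtain ⟨hQF, hgood⟩ := Finset.mem_filter.1 hQ
  rw [Finset.mem_powerset] at hQF
  refine ⟨Q, hQF, fun u hu v hv h => hgood u hu v hv (Or.inl h),
    fun u hu v hv h => hgood u hu v hv (Or.inr h), ?_⟩
  -- By maximality of `Q`, each member of `F` agrees with some member of `Q` on one side of the cut;
  -- otherwise it could be added to `Q`.
  have hcover : F ⊆ Q.biUnion fun q =>
      (Finset.univ.filter fun v : Fin d → Bool => ∀ i ∈ Xᶜ, q i = v i) ∪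
        Finset.univ.filter fun v : Fin d → Bool => ∀ i ∈ X, q i = v i := by
    intro v hv
    by_contra hno
    have hno' : ∀ q ∈ Q, ¬ ((∀ i ∈ X, q i = v i) ∨ ∀ i ∈ Xᶜ, q i = v i) := by
      intro q hq h
      refine hno (Finset.mem_biUnion.2 ⟨q, hq, ?_⟩)
      rw [Finset.mem_union, Finset.mem_filter, Finset.mem_filter]
      exact h.elim (fun h => Or.inr ⟨Finset.mem_univ _, h⟩) fun h => Or.inl ⟨Finset.mem_univ _, h⟩
    have hvQ : v ∉ Q := fun h => hno' v h (Or.inl fun _ _ => rfl)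
    have hins : insert v Q ∈ F.powerset.filter good := by
      refine Finset.mem_filter.2 ⟨Finset.mem_powerset.2 (Finset.insert_subset hv hQF), ?_⟩
      intro a ha b hb hab
      rcases Finset.mem_insert.1 ha with rfl | ha' <;> rcases Finset.mem_insert.1 hb with rfl | hb'
      · rfl
      · exact absurd (hab.imp (fun h i hi => (h i hi).symm) fun h i hi => (h i hi).symm)
          (hno' b hb')
      · exact absurd hab (hno' a ha')
      · exact hgood a ha' b hb' hab
    have := hmax _ hins
    rw [Finset.card_insert_of_notMem hvQ] at this
    omega
  calc F.card ≤ _ := Finset.card_le_card hcover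
    _ ≤ _ := Finset.card_biUnion_le_card_mul _ _ _ fun q _ => ?_
  refine (Finset.card_union_le _ _).trans (Nat.add_le_add ?_ (card_agree_le X q))
  have h := card_agree_le Xᶜ q
  have hX : X.card ≤ d := by simpa using Finset.card_le_univ X
  rwa [Finset.card_compl, Fintype.card_fin, Nat.sub_sub_self hX] at h

theorem card_primes_le {d : ℕ} :
    ((Finset.Ioc (2 ^ (d - 1)) (2 ^ d)).filter Nat.Prime).card ≤
      (Finset.univ.filter fun v : Fin d → Bool =>
        2 ^ (d - 1) < binaryValue v + 1 ∧ (binaryValue v + 1).Prime).card := by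
  refine le_trans (Finset.card_le_card fun p hp => ?_)
    (Finset.card_image_le (f := fun v => binaryValue v + 1))
  simp only [Finset.mem_filter, Finset.mem_Ioc] at hp
  obtain ⟨v, hv⟩ := exists_binaryValue_eq d (p - 1) (by have := hp.2.pos; omega)
  have hvp : binaryValue v + 1 = p := by have := hp.2.pos; omega
  exact Finset.mem_image.2 ⟨v, by simp only [Finset.mem_filter, hvp]; simp [hp], hvp⟩

/-! ### The exponential lower bound -/

namespace PC

/-- Along any cut, a function squaring to `binarySucc d` has communication rank at least the size
of any matching of large primes. -/
theorem le_card_node_of_matching {d : ℕ} (hd : 1 ≤ d) {C : PC (Fin d) Bool}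
    {a : C.Node → (Fin d → Bool) → ℝ} {X : Finset (Fin d)}
    (ha : ∀ P, DependsOn (a P) (X : Set (Fin d))) {f : (Fin d → Bool) → ℝ}
    (hf : C.InSpan a X f) (hsq : ∀ v, f v ^ 2 = binarySucc d v) (Q : Finset (Fin d → Bool))
    (hQ : ∀ v ∈ Q, 2 ^ (d - 1) < binaryValue v + 1 ∧ (binaryValue v + 1).Prime)
    (hX : ∀ u ∈ Q, ∀ v ∈ Q, (∀ i ∈ X, u i = v i) → u = v)
    (hXc : ∀ u ∈ Q, ∀ v ∈ Q, (∀ i ∈ Xᶜ, u i = v i) → u = v) :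
    Q.card ≤ Fintype.card C.Node := by
  let w : Fin Q.card → Fin d → Bool := fun i => (Q.equivFin.symm i).1
  have hw : ∀ i, w i ∈ Q := fun i => (Q.equivFin.symm i).2
  have hwinj : Function.Injective w := Subtype.val_injective.comp Q.equivFin.symm.injective
  have hself : ∀ x : Fin d → Bool, merge X x x = x := fun x => by ext i; simp [merge]
  refine hf.le_card_node ha w (det_ne_zero_of_sq_eq_prime _ _
    (fun i j => binaryValue (merge X (w i) (w j)) + 1) (fun i j => ?_) (fun i => ?_) ?_)
  · rw [Matrix.of_apply, hsq, binarySucc]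
    push_cast
    rfl
  · rw [hself]
    exact (hQ _ (hw i)).2
  · intro l i j hdvd
    rw [hself] at hdvd
    obtain ⟨c, hc⟩ := hdvd
    have h1 := (hQ _ (hw l)).1
    have h2 := binaryValue_lt (merge X (w i) (w j))
    have h3 : 2 ^ d = 2 ^ (d - 1) * 2 := by rw [← pow_succ, Nat.sub_add_cancel hd]
    -- The prime exceeds `2 ^ (d - 1)` and the entry is at most `2 ^ d`, so a multiple of the prime
    -- in this range is the prime itself.
    have hc1 : c = 1 := by
      rcases Nat.lt_or_ge c 2 with h | h
      · rcases Nat.eq_zero_or_pos c with rfl | h'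
        · omega
        · omega
      · have := Nat.mul_le_mul_left (binaryValue (w l) + 1) h
        omega
    rw [hc1, mul_one] at hc
    have heq : merge X (w i) (w j) = w l := binaryValue_injective d (Nat.succ_injective hc)
    constructor
    · refine hwinj (hX _ (hw i) _ (hw l) fun q hq => ?_)
      rw [← heq, merge, if_pos hq]
    · refine hwinj (hXc _ (hw j) _ (hw l) fun q hq => ?_)
      rw [← heq, merge, if_neg (Finset.mem_compl.1 hq)]

/-- Flipping a variable outside the scope would leave the circuit unchanged, whereas `binarySucc d`
is injective. -/
theorem scope_root_eq_univ {d : ℕ} {C : PC (Fin d) Bool}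
    (hsq : ∀ v, C.eval v ^ 2 = binarySucc d v) : C.scope C.root = Finset.univ := by
  rw [Finset.eq_univ_iff_forall]
  intro i
  by_contra hi
  have h : C.eval (fun _ => false) = C.eval (Function.update (fun _ => false) i true) :=
    C.nodeFun_dependsOn C.root fun j hj => by
      rw [Function.update_of_ne]
      rintro rfl
      exact hi hj
  have h' := hsq (Function.update (fun _ => false) i true)
  rw [← h, hsq, binarySucc, binarySucc, add_left_inj, Nat.cast_inj] at h'
  simpa using congrFun (binaryValue_injective d h') i

theorem two_pow_le_of_sq_eq_binarySucc {d k : ℕ} (hd : 4 ≤ d) (hkd : 3 * k ≤ 2 * d)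
    {C : PC (Fin d) Bool} (hC : C.StructuredDecomposable) (hk : C.InputArityLE k)
    (hsq : ∀ v, C.eval v ^ 2 = binarySucc d v) :
    ∃ x, 3 * x ≤ 2 * d ∧ 3 * (d - x) ≤ 2 * d ∧
      2 ^ d ≤ 3 * (d * (1 + (2 ^ d).sqrt + (C.size + 1) * (2 ^ x + 2 ^ (d - x)))) := by
  have huniv := scope_root_eq_univ hsq
  obtain ⟨X, -, hX1, hX2, a, ha, hspan⟩ := exists_balanced_cut hC hk d hkd Finset.univ
    (by rw [Finset.card_univ, Fintype.card_fin]; omega) ⟨_, huniv⟩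
  obtain ⟨Q, hQ, hQX, hQXc, hcard⟩ := exists_large_matching X
    (Finset.univ.filter fun v : Fin d → Bool =>
      2 ^ (d - 1) < binaryValue v + 1 ∧ (binaryValue v + 1).Prime)
  have hle := le_card_node_of_matching (by omega) ha (hspan _ huniv) hsq Q
    (fun v hv => (Finset.mem_filter.1 (hQ hv)).2) hQX hQXc
  refine ⟨X.card, hX2, by omega, (two_pow_le_card_primes d hd).trans ?_⟩
  gcongr
  exact card_primes_le.trans (hcard.trans (Nat.mul_le_mul_right _ (hle.trans C.card_node_le)))

/-- Structured-decomposable circuits squaring to `binarySucc d` have exponential size. -/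
theorem exponential_size_of_sq_eq_binarySucc :
    ∃ c : ℝ, 0 < c ∧ ∀ k : ℕ, ∃ d₀ : ℕ, ∀ d : ℕ, d₀ ≤ d → ∀ C : PC (Fin d) Bool,
      C.StructuredDecomposable → C.InputArityLE k →
      (∀ v, C.eval v ^ 2 = binarySucc d v) →
      (2 : ℝ) ^ (c * (d : ℝ)) ≤ (C.size : ℝ) := by
  -- With `t = 2 ^ (d / 6)`, a size below `t` would give `t ^ 6 ≤ 3 * d * (1 + t ^ 3 + 4 * t ^ 5) ≤
  -- 18 * d * t ^ 5`, which fails once `18 * d < t`. The exponent `1 / 6` turns all bounds into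
  -- integral powers of `t`.
  refine ⟨1 / 6, by norm_num, fun k => ?_⟩
  set r : ℝ := 2 ^ (1 / 6 : ℝ) with hr
  have hr6 : r ^ 6 = 2 := by
    rw [hr, ← Real.rpow_natCast, ← Real.rpow_mul (by norm_num)]
    norm_num
  have hr1 : 1 < r := Real.one_lt_rpow (by norm_num) (by norm_num)
  have hlim := (tendsto_pow_const_div_const_pow_of_one_lt 1 hr1).eventually
    (gt_mem_nhds (show (0 : ℝ) < 1 / 18 by norm_num))
  obtain ⟨d₁, hd₁⟩ := Filter.eventually_atTop.1 hlim
  refine ⟨max d₁ (max 4 (2 * k)), fun d hd C hC hk hsq => ?_⟩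
  have hdd₁ : d₁ ≤ d := (le_max_left _ _).trans hd
  have hd4 : 4 ≤ d := (le_max_left _ _).trans ((le_max_right _ _).trans hd)
  have hdk : 2 * k ≤ d := (le_max_right _ _).trans ((le_max_right _ _).trans hd)
  obtain ⟨x, hx1, hx2, hx⟩ := two_pow_le_of_sq_eq_binarySucc hd4 (by omega) hC hk hsq
  rw [Real.rpow_mul (by norm_num), Real.rpow_natCast, ← hr]
  set t := r ^ d with ht
  have ht1 : 1 ≤ t := one_le_pow₀ hr1.le
  have hdt : 18 * (d : ℝ) < t := by
    have := hd₁ d hdd₁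
    rw [pow_one, div_lt_iff₀ (by positivity)] at this
    linarith
  have hpow : ∀ y, (2 : ℝ) ^ y = r ^ (6 * y) := fun y => by rw [pow_mul, hr6]
  have h2d : (2 : ℝ) ^ d = t ^ 6 := by rw [hpow, ht, ← pow_mul, mul_comm]
  have h4 : ∀ y, 3 * y ≤ 2 * d → (2 : ℝ) ^ y ≤ t ^ 4 := fun y hy => by
    rw [hpow, ht, ← pow_mul]
    exact pow_le_pow_right₀ hr1.le (by omega)
  have hsqrt : (((2 ^ d).sqrt : ℕ) : ℝ) ≤ t ^ 3 := by
    refine Real.nat_sqrt_le_real_sqrt.trans ?_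
    rw [Real.sqrt_le_left (by positivity)]
    push_cast
    rw [h2d]
    exact le_of_eq (by ring)
  have hx' : (2 : ℝ) ^ d ≤
      3 * (d * (1 + ((2 ^ d).sqrt : ℕ) + (C.size + 1) * (2 ^ x + 2 ^ (d - x)))) := by
    exact_mod_cast hx
  by_contra! hlt
  have hS : ((C.size : ℝ) + 1) * (2 ^ x + 2 ^ (d - x)) ≤ (t + t) * (t ^ 4 + t ^ 4) :=
    mul_le_mul (by linarith) (add_le_add (h4 _ hx1) (h4 _ hx2)) (by positivity) (by positivity)
  have h15 : 1 ≤ t ^ 5 := one_le_pow₀ ht1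
  have h35 : t ^ 3 ≤ t ^ 5 := pow_le_pow_right₀ ht1 (by norm_num)
  have hin : 1 + ((2 ^ d).sqrt : ℕ) + ((C.size : ℝ) + 1) * (2 ^ x + 2 ^ (d - x)) ≤ 6 * t ^ 5 := by
    nlinarith
  have hd0 : (0 : ℝ) ≤ d := Nat.cast_nonneg d
  have hfin : t ^ 6 ≤ 3 * (d * (6 * t ^ 5)) := by
    rw [← h2d]
    exact hx'.trans (by gcongr)
  have : 3 * (d * (6 * t ^ 5)) < t ^ 6 := by
    have := mul_lt_mul_of_pos_right hdt (show 0 < t ^ 5 by positivity)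
    calc 3 * (d * (6 * t ^ 5)) = 18 * d * t ^ 5 := by ring
      _ < t * t ^ 5 := this
      _ = t ^ 6 := by ring
  linarith

end PC

/-! ### Constructing circuits: constants and tables of values -/

namespace PC

/-- A circuit from a graph graded by a rank function in which all nodes but one have a parent. -/
def ofRank {ι α : Type} (Node : Type) [Fintype Node] (inp : Node → Finset Node) (root : Node)
    (node : Node → PCNode ι α Node) (rank : Node → ℕ) (hrank : ∀ n, ∀ m ∈ inp n, rank m < rank n)
    (hparent : ∀ n, n ≠ root → ∃ m, n ∈ inp m)
    (hleaf : ∀ n, inp n = ∅ ↔ (node n).IsInput) : PC ι α where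
  Node := Node
  fin := inferInstance
  inp := inp
  acyclic := by
    have h : ∀ a b, Relation.TransGen (fun m n => m ∈ inp n) a b → rank a < rank b := by
      intro a b hab
      induction hab with
      | single h => exact hrank _ _ h
      | tail _ h ih => exact ih.trans (hrank _ _ h)
    exact fun n hn => lt_irrefl _ (h n n hn)
  root := root
  rooted := by
    classical
    -- Passing to a parent raises the rank, which is bounded, so the climb stops, and it can only
    -- stop at the root.
    obtain ⟨B, hB⟩ : ∃ B, ∀ n, rank n ≤ B :=
      ⟨Finset.univ.sup rank, fun n => Finset.le_sup (Finset.mem_univ n)⟩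
    intro n
    induction hk : B - rank n using Nat.strong_induction_on generalizing n with
    | _ k ih =>
      by_cases hn : n = root
      · rw [hn]
      · obtain ⟨m, hm⟩ := hparent n hn
        have h1 := hrank m n hm
        have h2 := hB m
        exact .head hm (ih _ (by omega) m rfl)
  node := node
  leaf_iff := hleaf

/-- Scopes of concrete circuits are found by guessing a closed form and checking the recursion;
`nodeFun_unique` does the same for the encoded functions. -/
theorem scope_unique {ι α : Type} [DecidableEq ι] (C : PC ι α) (sc : C.Node → Finset ι)
    (h : ∀ n, sc n = match C.node n with
      | .input W _ => W
      | .prod => (C.inp n).biUnion sc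
      | .sum _ => (C.inp n).biUnion sc) (n : C.Node) : C.scope n = sc n := by
  induction n using C.wf.induction with
  | _ n ih =>
    rw [C.scope_eq, h]
    cases C.node n with
    | input W f => rfl
    | prod => exact Finset.biUnion_congr rfl ih
    | sum θ => exact Finset.biUnion_congr rfl ih

theorem nodeFun_unique {ι α : Type} (C : PC ι α) (g : C.Node → (ι → α) → ℝ)
    (h : ∀ n x, g n x = match C.node n with
      | .input W f => f fun i : W => x i
      | .prod => ∏ m ∈ C.inp n, g m x
      | .sum θ => ∑ m ∈ C.inp n, θ m * g m x) (n : C.Node) (x : ι → α) :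
    C.nodeFun n x = g n x := by
  induction n using C.wf.induction with
  | _ n ih =>
    rw [C.nodeFun_eq, h]
    cases C.node n with
    | input W f => rfl
    | prod => exact Finset.prod_congr rfl ih
    | sum θ => exact Finset.sum_congr rfl fun m hm => by rw [ih m hm]

/-- The circuit with a single input node, computing a constant. -/
def const (ι α : Type) (c : ℝ) : PC ι α :=
  ofRank Unit (fun _ => ∅) () (fun _ => .input ∅ fun _ => c) (fun _ => 0) (by simp) (by simp)
    (by simp [PCNode.IsInput])

theorem const_structuredDecomposable (ι α : Type) [DecidableEq ι] (c : ℝ) :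
    (const ι α c).StructuredDecomposable :=
  ⟨fun _ h => h.elim, fun _ h => h.elim, fun _ _ h => h.elim⟩

theorem const_alternating (ι α : Type) (c : ℝ) : (const ι α c).Alternating :=
  fun _ _ _ => ⟨fun h => h.1.elim, fun h => h.1.elim⟩

theorem const_inputArityLE (ι α : Type) (c : ℝ) (k : ℕ) : (const ι α c).InputArityLE k :=
  fun _ => Nat.zero_le k

theorem const_monotone (ι α : Type) {c : ℝ} (hc : 0 ≤ c) : (const ι α c).Monotone :=
  fun _ _ => hc

theorem const_eval (ι α : Type) (c : ℝ) (x : ι → α) : (const ι α c).eval x = c := by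
  unfold eval
  rw [nodeFun_eq]
  rfl

theorem const_size (ι α : Type) (c : ℝ) : (const ι α c).size = 0 :=
  Finset.sum_eq_zero fun _ _ => Finset.card_empty

/-- Nodes of the circuit summing over all assignments. -/
abbrev TableNode (d : ℕ) : Type := Option ((Fin d → Bool) ⊕ (Fin d × Bool))

/-- Inputs of the nodes of the circuit summing over all assignments. -/
def tableInp (d : ℕ) : TableNode d → Finset (TableNode d)
  | none => Finset.univ.image fun w => some (.inl w)
  | some (.inl w) => Finset.univ.image fun i => some (.inr (i, w i))
  | some (.inr _) => ∅

/-- Weights of the root of the circuit summing over all assignments. -/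
def tableWeight {d : ℕ} (g : (Fin d → Bool) → ℝ) : TableNode d → ℝ
  | some (.inl w) => g w
  | _ => 0

/-- The types of the nodes of the circuit summing over all assignments. -/
def tableKind {d : ℕ} (g : (Fin d → Bool) → ℝ) : TableNode d → PCNode (Fin d) Bool (TableNode d)
  | none => .sum (tableWeight g)
  | some (.inl _) => .prod
  | some (.inr (i, b)) => .input {i} fun x => if x ⟨i, Finset.mem_singleton_self i⟩ = b then 1 else 0

/-- The circuit computing an arbitrary function as a sum over all assignments. -/
def table (e : ℕ) (g : (Fin (e + 1) → Bool) → ℝ) : PC (Fin (e + 1)) Bool :=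
  ofRank (TableNode (e + 1)) (tableInp (e + 1)) none (tableKind g)
    (fun n => match n with
      | none => 2
      | some (.inl _) => 1
      | some (.inr _) => 0)
    (by rintro (_ | w | p) m hm <;> simp [tableInp] at hm <;> obtain ⟨_, rfl⟩ := hm <;> simp)
    (by
      rintro (_ | w | ⟨i, b⟩) hn
      · simp at hn
      · exact ⟨none, by simp [tableInp]⟩
      · exact ⟨some (.inl fun _ => b), by simp [tableInp]⟩)
    (by
      rintro (_ | w | p) <;>
        simp [tableInp, tableKind, PCNode.IsInput, Finset.univ_nonempty.ne_empty])

section Table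

theorem mem_tableInp_none {d : ℕ} {m : TableNode d} :
    m ∈ tableInp d none ↔ ∃ w, some (.inl w) = m := by simp [tableInp]

theorem mem_tableInp_inl {d : ℕ} {w : Fin d → Bool} {m : TableNode d} :
    m ∈ tableInp d (some (.inl w)) ↔ ∃ i, some (.inr (i, w i)) = m := by simp [tableInp]

/-- The functions encoded by the nodes of the circuit summing over all assignments. -/
def tableFun {d : ℕ} (g : (Fin d → Bool) → ℝ) : TableNode d → (Fin d → Bool) → ℝ
  | none, x => g x
  | some (.inl w), x => if w = x then 1 else 0
  | some (.inr (i, b)), x => if x i = b then 1 else 0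

variable (e : ℕ) (g : (Fin (e + 1) → Bool) → ℝ)

theorem table_scope (n : TableNode (e + 1)) :
    (table e g).scope n = match n with
      | some (.inr (i, _)) => {i}
      | _ => Finset.univ := by
  refine scope_unique (table e g) (fun n : TableNode (e + 1) => match n with
      | some (.inr (i, _)) => {i}
      | _ => Finset.univ) ?_ n
  rintro (_ | w | ⟨i, b⟩)
  · ext i
    simp [table, ofRank, tableKind, tableInp]
  · ext i
    simp [table, ofRank, tableKind, tableInp]
  · rfl

theorem table_eval (x : Fin (e + 1) → Bool) : (table e g).eval x = g x := by
  refine nodeFun_unique (table e g) (tableFun g) ?_ none x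
  rintro (_ | w | ⟨i, b⟩) x
  · have h : ∑ m ∈ tableInp (e + 1) none, tableWeight g m * tableFun g m x = g x := by
      rw [tableInp, Finset.sum_image fun w _ w' _ h => Sum.inl.inj (Option.some.inj h)]
      simp [tableWeight, tableFun]
    exact h.symm
  · have h : ∏ m ∈ tableInp (e + 1) (some (.inl w)), tableFun g m x = if w = x then 1 else 0 := by
      rw [tableInp, Finset.prod_image fun i _ j _ h =>
        (Prod.mk.inj (Sum.inr.inj (Option.some.inj h))).1]
      by_cases h : w = x
      · simp [h, tableFun]
      · obtain ⟨i, hi⟩ := Function.ne_iff.1 h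
        rw [if_neg h, Finset.prod_eq_zero (Finset.mem_univ i)]
        exact if_neg (Ne.symm hi)
    exact h.symm
  · rfl

theorem table_structuredDecomposable : (table e g).StructuredDecomposable := by
  refine ⟨?_, ?_, ?_⟩
  · rintro (_ | w | p) hn m hm m' hm'
    · obtain ⟨w, rfl⟩ := mem_tableInp_none.1 hm
      obtain ⟨w', rfl⟩ := mem_tableInp_none.1 hm'
      rw [table_scope, table_scope]
    · exact hn.elim
    · exact hn.elim
  · rintro (_ | w | p) hn m hm m' hm' hne
    · exact hn.elim
    · obtain ⟨i, rfl⟩ := mem_tableInp_inl.1 hm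
      obtain ⟨j, rfl⟩ := mem_tableInp_inl.1 hm'
      rw [table_scope, table_scope, Finset.disjoint_singleton]
      rintro rfl
      exact hne rfl
    · exact hn.elim
  · have h : ∀ w : Fin (e + 1) → Bool,
        (table e g).blocks (some (.inl w) : TableNode (e + 1)) = {s | ∃ i, s = {i}} := by
      intro w
      ext s
      constructor
      · rintro ⟨-, m, hm, rfl⟩
        obtain ⟨i, rfl⟩ := mem_tableInp_inl.1 hm
        exact ⟨i, table_scope e g _⟩
      · rintro ⟨i, rfl⟩
        exact ⟨Finset.singleton_nonempty i, _, mem_tableInp_inl.2 ⟨i, rfl⟩,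
          table_scope e g _⟩
    rintro (_ | w | p) (_ | w' | p') hn hn' - <;> first | exact hn.elim | exact hn'.elim | skip
    exact (h w).trans (h w').symm

theorem table_alternating : (table e g).Alternating := by
  rintro (_ | w | p) m hm
  · obtain ⟨w, rfl⟩ := mem_tableInp_none.1 hm
    exact ⟨fun h => h.2, fun h => h.1⟩
  · obtain ⟨i, rfl⟩ := mem_tableInp_inl.1 hm
    exact ⟨fun h => h.1, fun h => h.2⟩
  · exact ⟨fun h => h.1, fun h => h.1⟩

theorem table_inputArityLE : (table e g).InputArityLE 1 := by
  rintro (_ | w | ⟨i, b⟩)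
  · trivial
  · trivial
  · exact (Finset.card_singleton i).le

end Table

end PC

theorem binarySucc_nonneg (d : ℕ) (v : Fin d → Bool) : 0 ≤ binarySucc d v := by
  unfold binarySucc
  positivity

theorem exists_circuit_sq_eq_binarySucc (d : ℕ) : ∃ C : PC (Fin d) Bool,
    C.StructuredDecomposable ∧ C.Alternating ∧ C.InputArityLE 1 ∧
      ∀ v, C.eval v ^ 2 = binarySucc d v := by
  cases d with
  -- Without variables the product nodes of a table would have no inputs, so a constant is used
  -- instead.
  | zero =>
    refine ⟨PC.const _ _ 1, PC.const_structuredDecomposable _ _ _, PC.const_alternating _ _ _,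
      PC.const_inputArityLE _ _ _ _, fun v => ?_⟩
    rw [PC.const_eval]
    simp [binarySucc, binaryValue]
  | succ e =>
    refine ⟨PC.table e fun v => √(binarySucc (e + 1) v), PC.table_structuredDecomposable _ _,
      PC.table_alternating _ _, PC.table_inputArityLE _ _, fun v => ?_⟩
    rw [PC.table_eval, Real.sq_sqrt (binarySucc_nonneg _ v)]

/-! ### The linear-size monotone circuit -/

/-- The nodes attached to the `i`-th digit in the linear-size circuit: `one` and `oneMul` compute
the constant `1` on the digits below `i` and up to `i`, `prefixSum` computes `1 + ∑ j ≤ i, 2 ^ j v j`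
as a combination of the products `keep` (of the previous such sum with `1`) and `add` (of `1` with
the digit `v i`), and `unit` and `digit` are the inputs `1` and `v i`. -/
inductive DigitKind : Type
  | one | oneMul | keep | add | prefixSum | unit | digit
  deriving DecidableEq

open DigitKind in
instance : Fintype DigitKind :=
  ⟨{one, oneMul, keep, add, prefixSum, unit, digit}, fun k => by cases k <;> simp⟩

namespace PC

open DigitKind

/-- Nodes of the linear-size circuit: one constant, and seven nodes for every digit. -/
abbrev DigitNode (e : ℕ) : Type := Option (DigitKind × Fin (e + 1))

/-- The node of kind `k` of the preceding digit. -/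
def prevNode {e : ℕ} (k : DigitKind) : Fin (e + 1) → DigitNode e :=
  Fin.cases none fun j => some (k, j.castSucc)

/-- Inputs of the nodes of the linear-size circuit. -/
def digitInp (e : ℕ) : DigitNode e → Finset (DigitNode e)
  | none => ∅
  | some (one, i) => {prevNode oneMul i}
  | some (oneMul, i) => {some (one, i), some (unit, i)}
  | some (keep, i) => {prevNode prefixSum i, some (unit, i)}
  | some (add, i) => {some (one, i), some (digit, i)}
  | some (prefixSum, i) => {some (oneMul, i), some (keep, i), some (add, i)}
  | some (unit, _) => ∅
  | some (digit, _) => ∅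

/-- Weights of the inputs of a `prefixSum` node. -/
def digitWeight {e : ℕ} : DigitNode e → ℝ
  | some (keep, _) => 1
  | some (add, i) => 2 ^ (i : ℕ)
  | _ => 0

/-- The types of the nodes of the linear-size circuit. -/
def digitNodeType {e : ℕ} : DigitNode e → PCNode (Fin (e + 1)) Bool (DigitNode e)
  | none => .input ∅ fun _ => 1
  | some (one, _) => .sum fun _ => 1
  | some (oneMul, _) => .prod
  | some (keep, _) => .prod
  | some (add, _) => .prod
  | some (prefixSum, _) => .sum digitWeight
  | some (unit, i) => .input {i} fun _ => 1
  | some (digit, i) => .input {i} fun x => if x ⟨i, Finset.mem_singleton_self i⟩ then 1 else 0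

/-- A rank function for the linear-size circuit. -/
def digitRank {e : ℕ} : DigitNode e → ℕ
  | none => 0
  | some (one, i) => 4 * i + 1
  | some (oneMul, i) => 4 * i + 2
  | some (keep, i) => 4 * i + 2
  | some (add, i) => 4 * i + 2
  | some (prefixSum, i) => 4 * i + 3
  | some (unit, _) => 0
  | some (digit, _) => 0

theorem digitRank_prevNode_lt {e : ℕ} (k : DigitKind) (i : Fin (e + 1)) :
    digitRank (prevNode k i) < 4 * i + 1 := by
  refine Fin.cases ?_ (fun j => ?_) i
  · simp [prevNode, digitRank]
  · cases k <;> simp [prevNode, digitRank] <;> omega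

/-- A circuit of linear size that adds up the weights of the digits one by one. -/
def digits (e : ℕ) : PC (Fin (e + 1)) Bool :=
  ofRank (DigitNode e) (digitInp e) (some (prefixSum, Fin.last e)) digitNodeType digitRank
    (by
      rintro (_ | ⟨k, i⟩) m hm
      · simp [digitInp] at hm
      · have h1 := digitRank_prevNode_lt oneMul i
        have h2 := digitRank_prevNode_lt prefixSum i
        cases k <;> simp only [digitInp, Finset.mem_insert, Finset.mem_singleton,
          Finset.notMem_empty] at hm <;> rcases hm with rfl | rfl | rfl <;>
          first
          | exact h1
          | exact h2.trans (Nat.lt_succ_self _)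
          | (simp only [digitRank]; omega))
    (by
      rintro (_ | ⟨k, i⟩) hn
      · exact ⟨some (one, 0), by simp [digitInp, prevNode]⟩
      · cases k with
        | one => exact ⟨some (oneMul, i), by simp [digitInp]⟩
        -- This edge has weight 0: it contributes nothing to the sum, but makes the last `oneMul`
        -- node reachable from the root.
        | oneMul => exact ⟨some (prefixSum, i), by simp [digitInp]⟩
        | keep => exact ⟨some (prefixSum, i), by simp [digitInp]⟩
        | add => exact ⟨some (prefixSum, i), by simp [digitInp]⟩
        | prefixSum =>
          revert hn
          refine Fin.lastCases (fun hn => (hn rfl).elim) (fun j _ => ?_) i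
          exact ⟨some (keep, j.succ), by simp [digitInp, prevNode]⟩
        | unit => exact ⟨some (oneMul, i), by simp [digitInp]⟩
        | digit => exact ⟨some (add, i), by simp [digitInp]⟩)
    (by rintro (_ | ⟨k, i⟩) <;> [skip; cases k] <;> simp [digitInp, digitNodeType, PCNode.IsInput])

/-- The scopes of the nodes of the linear-size circuit. -/
def digitScope {e : ℕ} : DigitNode e → Finset (Fin (e + 1))
  | none => ∅
  | some (one, i) => Finset.Iio i
  | some (oneMul, i) => Finset.Iic i
  | some (keep, i) => Finset.Iic i
  | some (add, i) => Finset.Iic i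
  | some (prefixSum, i) => Finset.Iic i
  | some (unit, i) => {i}
  | some (digit, i) => {i}

/-- At `i = 0` the predecessor is the constant node, whose empty scope is `Iio 0`, so the first
digit needs no separate treatment. -/
theorem digitScope_prevNode {e : ℕ} {k : DigitKind}
    (hk : ∀ i : Fin (e + 1), digitScope (some (k, i)) = Finset.Iic i) (i : Fin (e + 1)) :
    digitScope (prevNode k i) = Finset.Iio i := by
  refine Fin.cases ?_ (fun j => ?_) i
  · ext l
    simp [prevNode, digitScope]
  · ext l
    simp only [prevNode, Fin.cases_succ, hk, Finset.mem_Iic, Finset.mem_Iio]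
    exact Fin.le_castSucc_iff

theorem Iio_union_singleton {e : ℕ} (i : Fin (e + 1)) : Finset.Iio i ∪ {i} = Finset.Iic i := by
  ext l
  simp [le_iff_lt_or_eq]

theorem digits_scope (e : ℕ) (n : DigitNode e) : (digits e).scope n = digitScope n := by
  refine scope_unique (digits e) digitScope ?_ n
  have h1 := digitScope_prevNode (e := e) (k := oneMul) fun _ => rfl
  have h2 := digitScope_prevNode (e := e) (k := prefixSum) fun _ => rfl
  have key : ∀ n : DigitNode e, ¬ (digitNodeType n).IsInput →
      digitScope n = (digitInp e n).biUnion digitScope := by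
    rintro (_ | ⟨k, i⟩) hn
    · exact (hn trivial).elim
    · cases k with
      | one => simp [digitInp, h1]; rfl
      | oneMul => simp [digitInp, digitScope, Iio_union_singleton]
      | keep =>
        rw [digitInp, Finset.biUnion_insert, Finset.singleton_biUnion, h2]
        exact (Iio_union_singleton i).symm
      | add => simp [digitInp, digitScope, Iio_union_singleton]
      | prefixSum => simp [digitInp, digitScope]
      | unit => exact (hn trivial).elim
      | digit => exact (hn trivial).elim
  rintro (_ | ⟨k, i⟩)
  · rfl
  · cases k <;> first | rfl | exact key _ id

/-- The sum of the weights of the digits of `x` with indices in `s`. -/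
def digitSum {d : ℕ} (s : Finset (Fin d)) (x : Fin d → Bool) : ℝ :=
  ∑ i ∈ s, if x i then 2 ^ (i : ℕ) else 0

/-- The functions encoded by the nodes of the linear-size circuit. -/
def digitFun {e : ℕ} : DigitNode e → (Fin (e + 1) → Bool) → ℝ
  | some (keep, i), x => digitSum (Finset.Iio i) x + 1
  | some (add, i), x => if x i then 1 else 0
  | some (prefixSum, i), x => digitSum (Finset.Iic i) x + 1
  | some (digit, i), x => if x i then 1 else 0
  | _, _ => 1

theorem digitFun_prevNode_oneMul {e : ℕ} (i : Fin (e + 1)) (x : Fin (e + 1) → Bool) :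
    digitFun (prevNode oneMul i) x = 1 :=
  Fin.cases rfl (fun _ => rfl) i

theorem digitFun_prevNode_prefixSum {e : ℕ} (i : Fin (e + 1)) (x : Fin (e + 1) → Bool) :
    digitFun (prevNode prefixSum i) x = digitSum (Finset.Iio i) x + 1 := by
  rw [← digitScope_prevNode (k := prefixSum) (fun _ => rfl) i]
  refine Fin.cases ?_ (fun j => ?_) i
  · simp [prevNode, digitFun, digitScope, digitSum]
  · rfl

theorem digitSum_Iic {e : ℕ} (i : Fin (e + 1)) (x : Fin (e + 1) → Bool) :
    digitSum (Finset.Iic i) x = digitSum (Finset.Iio i) x + if x i then 2 ^ (i : ℕ) else 0 := by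
  rw [← Iio_union_singleton, digitSum, Finset.sum_union (by simp), Finset.sum_singleton, digitSum]

/-- Inputs form a set, so a two-factor product requires the two input nodes to be distinct. -/
theorem prevNode_ne_some_unit {e : ℕ} {k : DigitKind} (hk : k ≠ unit) (i j : Fin (e + 1)) :
    prevNode k i ≠ some (unit, j) := by
  refine Fin.cases ?_ (fun l => ?_) i
  · simp [prevNode]
  · simp [prevNode, hk]

theorem digits_nodeFun (e : ℕ) (n : DigitNode e) (x : Fin (e + 1) → Bool) :
    (digits e).nodeFun n x = digitFun n x := by
  refine nodeFun_unique (digits e) digitFun ?_ n x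
  rintro (_ | ⟨k, i⟩) x
  · rfl
  · cases k with
    | one =>
      have h : ∑ m ∈ digitInp e (some (one, i)), 1 * digitFun m x = 1 := by
        simp [digitInp, digitFun_prevNode_oneMul]
      exact h.symm
    | oneMul =>
      have h : ∏ m ∈ digitInp e (some (oneMul, i)), digitFun m x = 1 := by
        rw [digitInp, Finset.prod_pair (by simp)]
        simp [digitFun]
      exact h.symm
    | keep =>
      have h : ∏ m ∈ digitInp e (some (keep, i)), digitFun m x =
          digitSum (Finset.Iio i) x + 1 := by
        rw [digitInp, Finset.prod_pair (prevNode_ne_some_unit (by simp) _ _),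
          digitFun_prevNode_prefixSum]
        simp [digitFun]
      exact h.symm
    | add =>
      have h : ∏ m ∈ digitInp e (some (add, i)), digitFun m x = if x i then 1 else 0 := by
        rw [digitInp, Finset.prod_pair (by simp)]
        simp [digitFun]
      exact h.symm
    | prefixSum =>
      have h : ∑ m ∈ digitInp e (some (prefixSum, i)), digitWeight m * digitFun m x =
          digitSum (Finset.Iic i) x + 1 := by
        rw [digitInp, Finset.sum_insert (by simp), Finset.sum_pair (by simp), digitSum_Iic]
        simp only [digitWeight, digitFun]
        split_ifs <;> ring
      exact h.symm
    | unit => rfl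
    | digit => rfl

theorem digits_eval (e : ℕ) (x : Fin (e + 1) → Bool) :
    (digits e).eval x = binarySucc (e + 1) x := by
  refine (digits_nodeFun e (some (prefixSum, Fin.last e)) x).trans ?_
  have h : Finset.Iic (Fin.last e) = Finset.univ := by
    ext l
    simp [Fin.le_last]
  simp only [digitFun, h, digitSum, binarySucc, binaryValue]
  push_cast
  rfl

theorem digits_monotone (e : ℕ) : (digits e).Monotone := by
  have hw : ∀ n : DigitNode e, 0 ≤ digitWeight n := by
    rintro (_ | ⟨k, i⟩)
    · exact le_rfl
    · cases k <;> simp [digitWeight]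
  rintro (_ | ⟨k, i⟩)
  · exact fun _ => zero_le_one
  · cases k with
    | one => exact fun _ _ => zero_le_one
    | oneMul => trivial
    | keep => trivial
    | add => trivial
    | prefixSum => exact fun m _ => hw m
    | unit => exact fun _ => zero_le_one
    | digit =>
      intro w
      change (0 : ℝ) ≤ if _ then 1 else 0
      split_ifs <;> norm_num

theorem digits_inputArityLE (e : ℕ) : (digits e).InputArityLE 1 := by
  rintro (_ | ⟨k, i⟩)
  · exact Nat.zero_le 1
  · cases k <;> first | trivial | exact (Finset.card_singleton i).le

theorem digits_alternating (e : ℕ) : (digits e).Alternating := by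
  have h : ∀ n : DigitNode e, ∀ m ∈ digitInp e n,
      ¬ ((digitNodeType n).IsSum ∧ (digitNodeType m).IsSum) ∧
        ¬ ((digitNodeType n).IsProd ∧ (digitNodeType m).IsProd) := by
    have h1 : ∀ i : Fin (e + 1), ¬ (digitNodeType (prevNode oneMul i)).IsSum :=
      fun i => Fin.cases id (fun _ => id) i
    have h2 : ∀ i : Fin (e + 1), ¬ (digitNodeType (prevNode prefixSum i)).IsProd :=
      fun i => Fin.cases id (fun _ => id) i
    rintro (_ | ⟨k, i⟩) m hm
    · simp [digitInp] at hm
    · cases k <;> simp only [digitInp, Finset.mem_insert, Finset.mem_singleton,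
        Finset.notMem_empty] at hm <;> rcases hm with rfl | rfl | rfl <;>
        first
        | exact ⟨fun h => h1 i h.2, fun h => h.1⟩
        | exact ⟨fun h => h.1, fun h => h2 i h.2⟩
        | simp [digitNodeType, PCNode.IsSum, PCNode.IsProd]
  exact h

/-- The inputs of a product node of the linear-size circuit. -/
theorem digitInp_of_isProd {e : ℕ} {n : DigitNode e} (hn : (digitNodeType n).IsProd) :
    ∃ i a b, digitScope n = Finset.Iic i ∧ digitInp e n = {a, b} ∧
      digitScope a = Finset.Iio i ∧ digitScope b = {i} := by
  rcases n with _ | ⟨k, i⟩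
  · exact hn.elim
  · cases k with
    | oneMul => exact ⟨i, _, _, rfl, rfl, rfl, rfl⟩
    | keep => exact ⟨i, _, _, rfl, rfl, digitScope_prevNode (fun _ => rfl) i, rfl⟩
    | add => exact ⟨i, _, _, rfl, rfl, rfl, rfl⟩
    | one => exact hn.elim
    | prefixSum => exact hn.elim
    | unit => exact hn.elim
    | digit => exact hn.elim

theorem digits_structuredDecomposable (e : ℕ) : (digits e).StructuredDecomposable := by
  refine ⟨?_, ?_, ?_⟩
  · have h : ∀ n : DigitNode e, (digitNodeType n).IsSum → ∀ m ∈ digitInp e n,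
        ∀ m' ∈ digitInp e n, digitScope m = digitScope m' := by
      rintro (_ | ⟨k, i⟩) hn m hm m' hm'
      · exact hn.elim
      · cases k with
        | one =>
          rw [digitInp, Finset.mem_singleton] at hm hm'
          rw [hm, hm']
        | prefixSum =>
          simp only [digitInp, Finset.mem_insert, Finset.mem_singleton] at hm hm'
          rcases hm with rfl | rfl | rfl <;> rcases hm' with rfl | rfl | rfl <;> rfl
        | oneMul => exact hn.elim
        | keep => exact hn.elim
        | add => exact hn.elim
        | unit => exact hn.elim
        | digit => exact hn.elim
    intro n hn m hm m' hm'
    exact (digits_scope e m).trans ((h n hn m hm m' hm').trans (digits_scope e m').symm)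
  · intro n hn m hm m' hm' hne
    obtain ⟨i, a, b, -, hab, ha, hb⟩ := digitInp_of_isProd hn
    have hdisj : Disjoint (Finset.Iio i) {i} := by simp
    have hmem : ∀ m, m ∈ digitInp e n ↔ m = a ∨ m = b := by simp [hab]
    have hm1 := digits_scope e m
    have hm2 := digits_scope e m'
    rw [hm1, hm2]
    rcases (hmem m).1 hm with rfl | rfl <;> rcases (hmem m').1 hm' with rfl | rfl
    · exact (hne rfl).elim
    · rwa [ha, hb]
    · rw [ha, hb]
      exact hdisj.symm
    · exact (hne rfl).elim
  · have h : ∀ n : DigitNode e, (digitNodeType n).IsProd → ∃ i, digitScope n = Finset.Iic i ∧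
        (digits e).blocks n = {s | s.Nonempty ∧ (s = Finset.Iio i ∨ s = {i})} := by
      intro n hn
      obtain ⟨i, a, b, hi, hab, ha, hb⟩ := digitInp_of_isProd hn
      have hmem : ∀ m, m ∈ digitInp e n ↔ m = a ∨ m = b := by simp [hab]
      refine ⟨i, hi, Set.ext fun s => and_congr_right fun _ => ?_⟩
      constructor
      · rintro ⟨m, hm, rfl⟩
        rw [digits_scope e m]
        rcases (hmem m).1 hm with rfl | rfl
        · exact Or.inl ha
        · exact Or.inr hb
      · rintro (rfl | rfl)
        · exact ⟨a, (hmem a).2 (Or.inl rfl), (digits_scope e a).trans ha⟩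
        · exact ⟨b, (hmem b).2 (Or.inr rfl), (digits_scope e b).trans hb⟩
    intro n n' hn hn' hnn'
    obtain ⟨i, hi, hb⟩ := h n hn
    obtain ⟨i', hi', hb'⟩ := h n' hn'
    have hs := (hi.symm.trans ((digits_scope e n).symm.trans
      (hnn'.trans (digits_scope e n')))).trans hi'
    have hii' : i = i' := le_antisymm (Finset.mem_Iic.1 (hs ▸ Finset.mem_Iic.2 le_rfl))
      (Finset.mem_Iic.1 (hs.symm ▸ Finset.mem_Iic.2 le_rfl))
    rw [hb, hb', hii']

theorem digits_size_le (e : ℕ) : (digits e).size ≤ 21 * (e + 1) := by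
  have h3 : ∀ p, (digitInp e (some p)).card ≤ 3 := by
    rintro ⟨k, i⟩
    cases k with
    | one => simp [digitInp]
    | oneMul => exact Finset.card_le_two.trans (by norm_num)
    | keep => exact Finset.card_le_two.trans (by norm_num)
    | add => exact Finset.card_le_two.trans (by norm_num)
    | prefixSum => exact Finset.card_le_three
    | unit => simp [digitInp]
    | digit => simp [digitInp]
  have h : ∑ n : DigitNode e, (digitInp e n).card ≤ 21 * (e + 1) := by
    rw [Fintype.sum_option]
    have h0 : (digitInp e none).card = 0 := rfl
    rw [h0, zero_add]
    -- The constant 21 is seven nodes per digit with at most three inputs each.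
    refine (Finset.sum_le_card_nsmul _ _ 3 fun p _ => h3 p).trans ?_
    rw [Finset.card_univ, Fintype.card_prod, Fintype.card_fin,
      show Fintype.card DigitKind = 7 from rfl, smul_eq_mul]
    omega
  exact h

end PC

theorem exists_linear_size_circuit : ∃ A : ℕ, ∀ d : ℕ, ∃ C : PC (Fin d) Bool,
    C.Monotone ∧ C.StructuredDecomposable ∧ C.Alternating ∧ C.InputArityLE 1 ∧
      (∀ v, C.eval v = binarySucc d v) ∧ C.size ≤ A * d := by
  refine ⟨21, fun d => ?_⟩
  cases d with
  | zero =>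
    -- For `d = 0` the bound `A * d` allows no edges, so the circuit is a single node.
    refine ⟨PC.const _ _ 1, PC.const_monotone _ _ zero_le_one,
      PC.const_structuredDecomposable _ _ _, PC.const_alternating _ _ _,
      PC.const_inputArityLE _ _ _ _, fun v => ?_, (PC.const_size _ _ _).le⟩
    rw [PC.const_eval]
    simp [binarySucc, binaryValue]
  | succ e =>
    exact ⟨PC.digits e, PC.digits_monotone e, PC.digits_structuredDecomposable e,
      PC.digits_alternating e, PC.digits_inputArityLE e, PC.digits_eval e, PC.digits_size_le e⟩

theorem mainTheorem1 :
    -- the functions are nonnegative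
    (∀ (d : ℕ) (v : Fin d → Bool), 0 ≤ binarySucc d v) ∧
    -- linear-size monotone structured-decomposable circuits
    (∃ A : ℕ, ∀ d : ℕ, ∃ C : PC (Fin d) Bool,
      C.Monotone ∧ C.StructuredDecomposable ∧ C.Alternating ∧ C.InputArityLE 1 ∧
      (∀ v, C.eval v = binarySucc d v) ∧ C.size ≤ A * d) ∧
    -- structured-decomposable circuits whose square is the function exist
    (∀ d : ℕ, ∃ C : PC (Fin d) Bool,
      C.StructuredDecomposable ∧ C.Alternating ∧ C.InputArityLE 1 ∧
      ∀ v, C.eval v ^ 2 = binarySucc d v) ∧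
    -- and all of them have exponential size
    (∃ c : ℝ, 0 < c ∧ ∀ k : ℕ, ∃ d₀ : ℕ, ∀ d : ℕ, d₀ ≤ d → ∀ C : PC (Fin d) Bool,
      C.StructuredDecomposable → C.InputArityLE k →
      (∀ v, C.eval v ^ 2 = binarySucc d v) →
      (2 : ℝ) ^ (c * (d : ℝ)) ≤ (C.size : ℝ)) :=
  ⟨binarySucc_nonneg, exists_linear_size_circuit, exists_circuit_sq_eq_binarySucc,
    PC.exponential_size_of_sq_eq_binarySucc⟩
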